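/- **Setting.** Let $T_n$ be the ternary rooted tree of height $n$; its leaves are the words of length $n$ over $\{0,1,2\}$, the children of a word $w$ being $w0,w1,w2$. Automorphisms act on the right (in a product $\sigma\tau$ the factor $\sigma$ is applied first), $g^h:=hgh^{-1}$, and $\mathrm{Aut}(T_{n-1})$ is embedded in $\mathrm{Aut}(T_n)$ by $\sigma\mapsto(\sigma,\mathrm{id},\mathrm{id})$, i.e. $\sigma$ acts on the words that begin with $0$ (on the remaining letters) and all other words are fixed. *Typed automorphisms.* Let $\sigma\in\mathrm{Aut}(T_n)$ and let each cycle of $\sigma$ on the words of length $n$ (fixed points included) carry a type $s$ or $n$. Write each cycle so that it ends in its lexicographically largest word. The iteration of $\sigma$ is $\sigma'\in \mathrm{Aut}(T_{n+1})$, $\sigma'(wa)=\sigma(w)\,s_w(a)$, where, if $w$ is the last word of its cycle, $s_w=(0,1,2)$ for a cycle of type $s$ (tripling) and $s_w=(0,1)$ for a cycle of type $n$ (doubling), and $s_w=\mathrm{id}$ otherwise. A cycle of type $s$ and length $k$ gives a cycle of type $s$ and length $3k$; a cycle of type $n$ and length $k$ gives a cycle of type $n$ and length $2k$ and one of type $s$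 and length $k$ (the latter on words ending in $2$). Let $x_1=(0,1,2)$ with type $s$; $y_1=(0,1)$ with type $n$ on $(0,1)$ and $s$ on $(2)$; $z_1=\mathrm{id}$ with types $n,n,s$ on $(0),(1),(2)$; and let $x_n,y_n,z_n\in\mathrm{Aut}(T_n)$ be obtained from these by iterating $n-1$ times. *Groups.* $L_0=1$, and for $n\ge1$ $$L_n=\langle x_n,z_n,L_{n-1}\rangle,\quad M_n=\langle x_n,y_n,z_n,L_{n-1}\rangle,\quad H_n=\langle L_{n-1}\rangle^{L_n},\quad K_n=\langle H_n,z_n\rangle^{L_n},$$ where $\langle S\rangle^{G}$ is the subgroup generated by all $G$-conjugates of elements of $S$. *Cycle data of sets.* For $S_1\subseteq S_2\subseteq\mathrm{Aut}(T_n)$, $CD(S_1,S_2)$ is the set of pairs $(c,q_c)$, where $c$ runs over the cycle types (partitions of $3^n$, fixed points counted as parts $1$) that occur in $S_1$, and $q_c=p_c\,|S_1|/|S_2|$, with $p_c$ the proportion of elements of $S_1$ of cycle type $c$. *Markov process.* States are multisets of pairs $[t,k]$ with $t\in\{s,n\}$ and $k$ a positive integer (a length), with weights. In one step all members of a multiset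 evolve independently, with $$[s,k]\to([s,3k],\tfrac23),\ ([s,k]^3,\tfrac1{12}),\ ([s,k][n,k]^2,\tfrac14);\qquad [n,k]\to([n,2k][s,k],\tfrac12),\ ([s,2k][n,k],\tfrac12),$$ and weights are multiplied. For $n\ge 1$ let $A_1^{(n)},A_2^{(n)},A_3^{(n)},A_4^{(n)}$ be the cycle data obtained by applying the process $n-1$ times to $([s,1]^3,\frac1{12})$, $([s,3],\frac23)$, $([n,1]^2[s,1],\frac14)$, $([n,1],\frac12)$, respectively: the set of pairs $(c,q)$, where $c$ is a multiset of lengths that occurs and $q$ is the total weight of all states with these lengths. **Theorem.** For all $n\ge2$: 1. $A_1^{(n)}=CD(H_n,L_n)$; 2. $A_2^{(n)}=CD(K_nx_n\sqcup K_nx_n^2,\,L_n)$; 3. $A_3^{(n)}=CD(z_nH_n\sqcup z_n^{x_n}H_n\sqcup z_n^{x_n^2}H_n,\,L_n)$; 4. $A_4^{(n+1)}=CD(L_ny_n,M_n)$. Here $\sqcup$ asserts that the unions are disjoint. -/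

import Mathlib

namespace CubicMarkov

noncomputable section

/-! ### The ternary tree of height `n` and its automorphisms -/

/-- Vertices on level `n` of the ternary rooted tree: words of length `n` in `{0, 1, 2}`.
The children of `w` are the words `w a`, with the new letter at the end. -/
abbrev Word (n : ℕ) : Type := Fin n → Fin 3

/-- `Aut(T_n)`, as permutations of the leaves of `T_n` (the words of length `n`): those which
respect, for each `k`, the relation of having the same ancestor on level `k`. -/
def treeAut (n : ℕ) : Subgroup (Equiv.Perm (Word n)) where
  carrier := {σ | ∀ (k : ℕ) (u v : Word n),
    (∀ i : Fin n, i.val < k → σ u i = σ v i) ↔ (∀ i : Fin n, i.val < k → u i = v i)}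
  one_mem' := fun _ _ _ => Iff.rfl
  mul_mem' := fun {σ τ} hσ hτ k u v => (hσ k (τ u) (τ v)).trans (hτ k u v)
  inv_mem' := fun {σ} hσ k u v => by
    have h := hσ k (σ⁻¹ u) (σ⁻¹ v)
    simpa using h.symm

/-- The embedding `σ ↦ (σ, id, id)` of automorphisms of `T_n` into automorphisms of `T_{n+1}`. -/
def embed {n : ℕ} (σ : Equiv.Perm (Word n)) : Equiv.Perm (Word (n + 1)) where
  toFun u := if u 0 = 0 then Fin.cons 0 (σ (Fin.tail u)) else u
  invFun u := if u 0 = 0 then Fin.cons 0 (σ.symm (Fin.tail u)) else u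
  left_inv u := by
    by_cases h : u 0 = 0
    · have e : (Fin.cons 0 (Fin.tail u) : Word (n + 1)) = u := by
        rw [← h]; exact Fin.cons_self_tail u
      simp [h, e]
    · simp [h]
  right_inv u := by
    by_cases h : u 0 = 0
    · have e : (Fin.cons 0 (Fin.tail u) : Word (n + 1)) = u := by
        rw [← h]; exact Fin.cons_self_tail u
      simp [h, e]
    · simp [h]

/-- The extension `i_{s}(σ) : w a ↦ σ(w) s_w(a)` of `σ` to the next level, given by a family `s`
of permutations of `{0, 1, 2}` indexed by the words of length `n`. -/
def extend {n : ℕ} (s : Word n → Equiv.Perm (Fin 3)) (σ : Equiv.Perm (Word n)) :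
    Equiv.Perm (Word (n + 1)) where
  toFun u := Fin.snoc (σ (Fin.init u)) (s (Fin.init u) (u (Fin.last n)))
  invFun u := Fin.snoc (σ.symm (Fin.init u)) ((s (σ.symm (Fin.init u))).symm (u (Fin.last n)))
  left_inv u := by simp
  right_inv u := by simp

/-! ### Types, and the iteration of typed automorphisms -/

/-- The types of irreducible factors / cycles: `s` (square) and `n` (non-square). -/
inductive Label : Type
  | s : Label
  | n : Label
  deriving DecidableEq

/-- A permutation of the words of length `n` together with a type for each of its disjoint
cycles (fixed points included): `label w` is the type of the cycle through `w`. -/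
structure Typed (n : ℕ) where
  perm : Equiv.Perm (Word n)
  label : Word n → Label
  label_perm : ∀ w, label (perm w) = label w

/-- `w` is the last element of its `σ`-cycle, the cycle being written so that it ends in its
largest element for the lexicographic order of words. -/
def IsLastInCycle {n : ℕ} (σ : Equiv.Perm (Word n)) (w : Word n) : Prop :=
  ∀ v : Word n, σ.SameCycle w v → toLex v ≤ toLex w

/-- The permutation inserted over `w`: `(0,1,2)` if `w` is the last element of a cycle of type `s`
(tripling), `(0,1)` if it is the last element of a cycle of type `n` (doubling), and the identity
if `w` is not the last element of its cycle. -/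
def insertion {n : ℕ} (g : Typed n) (w : Word n) : Equiv.Perm (Fin 3) :=
  open Classical in
  if IsLastInCycle g.perm w then
    match g.label w with
    | Label.s => finRotate 3
    | Label.n => Equiv.swap 0 1
  else 1

/-- The type of the new cycle through `w a`, where the cycle through `w` has type `t`:
`[s,k] → [s,3k]` and `[n,k] → [n,2k][s,k]`, the cycle of length `k` being the one through the
words that end in the letter `2`. -/
def childLabel : Label → Fin 3 → Label
  | Label.s, _ => Label.s
  | Label.n, a => if a = 2 then Label.s else Label.n

/-- One iteration of a typed permutation: triple each cycle of type `s`, double each cycle of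
type `n`, and give the new cycles their types. -/
def iterate {n : ℕ} (g : Typed n) : Typed (n + 1) where
  perm := extend (insertion g) g.perm
  label u := childLabel (g.label (Fin.init u)) (u (Fin.last n))
  label_perm u := by
    simp only [extend, Equiv.coe_fn_mk, Fin.init_snoc, Fin.snoc_last, g.label_perm, insertion]
    generalize u (Fin.last n) = a
    split_ifs
    · cases g.label (Fin.init u)
      · rfl
      · revert a; decide
    · rfl

/-- A permutation of `{0, 1, 2}` as a permutation of the words of length one. -/
def level1 (π : Equiv.Perm (Fin 3)) : Equiv.Perm (Word 1) :=
  (Equiv.funUnique (Fin 1) (Fin 3)).symm.permCongr π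

/-- `(0,1,2)` with type `[s,3]`, iterated up to level `n + 1`. -/
def xTyped : (n : ℕ) → Typed (n + 1)
  | 0 => { perm := level1 (finRotate 3), label := fun _ => Label.s, label_perm := fun _ => rfl }
  | n + 1 => iterate (xTyped n)

/-- `(0,1)` with type `[n,2][s,1]`, iterated up to level `n + 1`. -/
def yTyped : (n : ℕ) → Typed (n + 1)
  | 0 =>
    { perm := level1 (Equiv.swap 0 1)
      label := fun w => if w 0 = 2 then Label.s else Label.n
      label_perm := by decide }
  | n + 1 => iterate (yTyped n)

/-- The identity with type `[n,1][n,1][s,1]` (on the cycles `(0)`, `(1)`, `(2)`, in this order),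
iterated up to level `n + 1`. -/
def zTyped : (n : ℕ) → Typed (n + 1)
  | 0 =>
    { perm := 1
      label := fun w => if w 0 = 2 then Label.s else Label.n
      label_perm := fun _ => rfl }
  | n + 1 => iterate (zTyped n)

/-- `x_n`, an automorphism of `T_n` (for `n ≥ 1`; the identity for `n = 0`). -/
def x : (n : ℕ) → Equiv.Perm (Word n)
  | 0 => 1
  | n + 1 => (xTyped n).perm

/-- `y_n`, an automorphism of `T_n` (for `n ≥ 1`; the identity for `n = 0`). -/
def y : (n : ℕ) → Equiv.Perm (Word n)
  | 0 => 1
  | n + 1 => (yTyped n).perm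

/-- `z_n`, an automorphism of `T_n` (for `n ≥ 1`; the identity for `n = 0`). -/
def z : (n : ℕ) → Equiv.Perm (Word n)
  | 0 => 1
  | n + 1 => (zTyped n).perm

/-! ### The groups -/

/-- The normal closure `⟨S⟩^G`: the subgroup generated by the `G`-conjugates of elements of `S`. -/
def normalClosureIn {Γ : Type*} [Group Γ] (G : Subgroup Γ) (S : Set Γ) : Subgroup Γ :=
  Subgroup.closure {a | ∃ g ∈ G, ∃ b ∈ S, a = g * b * g⁻¹}

/-- `L_n = ⟨x_n, z_n, L_{n-1}⟩`, with `L_0` trivial. -/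
def L : (n : ℕ) → Subgroup (Equiv.Perm (Word n))
  | 0 => ⊥
  | n + 1 => Subgroup.closure ({x (n + 1), z (n + 1)} ∪ embed '' (L n : Set (Equiv.Perm (Word n))))

/-- `M_n = ⟨x_n, y_n, z_n, L_{n-1}⟩`. -/
def M : (n : ℕ) → Subgroup (Equiv.Perm (Word n))
  | 0 => ⊥
  | n + 1 => Subgroup.closure
      ({x (n + 1), y (n + 1), z (n + 1)} ∪ embed '' (L n : Set (Equiv.Perm (Word n))))

/-- `H_n = ⟨L_{n-1}⟩^{L_n}`. -/
def H : (n : ℕ) → Subgroup (Equiv.Perm (Word n))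
  | 0 => ⊥
  | n + 1 => normalClosureIn (L (n + 1)) (embed '' (L n : Set (Equiv.Perm (Word n))))

/-- `K_n = ⟨H_n, z_n⟩^{L_n}`. -/
def K (n : ℕ) : Subgroup (Equiv.Perm (Word n)) :=
  normalClosureIn (L n) (Subgroup.closure ((H n : Set (Equiv.Perm (Word n))) ∪ {z n}))

/-! Automorphisms act on the right: in a product `σ τ` the factor `σ` is applied first, so
that `σ τ` is `σ.trans τ`.  The three definitions below use this convention. -/

/-- The conjugate `g ^ h = h g h⁻¹`. -/
def conj {α : Type*} (g h : Equiv.Perm α) : Equiv.Perm α := (h.trans g).trans h.symm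

/-- The coset `G g`. -/
def cosetR {α : Type*} (G : Subgroup (Equiv.Perm α)) (g : Equiv.Perm α) : Set (Equiv.Perm α) :=
  {a | ∃ k ∈ G, a = k.trans g}

/-- The coset `g G`. -/
def cosetL {α : Type*} (g : Equiv.Perm α) (G : Subgroup (Equiv.Perm α)) : Set (Equiv.Perm α) :=
  {a | ∃ k ∈ G, a = g.trans k}

/-! ### Cycle data of sets of automorphisms -/

/-- The cycle type of `σ` as a partition of `3 ^ n`: the multiset of the lengths of all its
cycles, fixed points included. -/
def cycleLengths {n : ℕ} (σ : Equiv.Perm (Word n)) : Multiset ℕ := σ.partition.parts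

/-- `CD(S₁, S₂)` for `S₁ ⊆ S₂ ⊆ Aut(T_n)`: the set of pairs `(c, q_c)`, for `c` a cycle type that occurs in `S₁`, with
`q_c = p_c |S₁| / |S₂|`, where `p_c` is the proportion of elements of `S₁` with cycle type `c`. -/
def CD (n : ℕ) (S₁ S₂ : Set (Equiv.Perm (Word n))) : Set (Multiset ℕ × ℚ) :=
  {p | (∃ σ ∈ S₁, cycleLengths σ = p.1) ∧
    p.2 = (({σ ∈ S₁ | cycleLengths σ = p.1}.ncard : ℚ) / (S₁.ncard : ℚ)) *
      ((S₁.ncard : ℚ) / (S₂.ncard : ℚ))}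

/-! ### The Markov process -/

/-- A type sequence `[t₁,k₁]⋯[t_r,k_r]`: a multiset of types with lengths. -/
abbrev TypeSeq : Type := Multiset (Label × ℕ)

/-- A collection of data: finitely many type sequences, each with a weight.  The sum
superposes collections (adding the weights of equal type sequences); the product of
`single t p` and `single t' p'` is `single (t + t') (p * p')`, i.e. independent juxtaposition. -/
abbrev Data : Type := AddMonoidAlgebra ℚ TypeSeq

/-- The datum consisting of one type sequence with weight `p`. -/
def datum (t : TypeSeq) (p : ℚ) : Data := AddMonoidAlgebra.single t p

/-- The transition for one factor (combined critical orbit of length one):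
`[s,k] → ([s,3k], 2/3), ([s,k]³, 1/12), ([s,k][n,k]², 1/4)` and
`[n,k] → ([n,2k][s,k], 1/2), ([s,2k][n,k], 1/2)`. -/
def transition : Label × ℕ → Data
  | (Label.s, k) =>
      datum {(Label.s, 3 * k)} (2 / 3)
        + datum {(Label.s, k), (Label.s, k), (Label.s, k)} (1 / 12)
        + datum {(Label.s, k), (Label.n, k), (Label.n, k)} (1 / 4)
  | (Label.n, k) =>
      datum {(Label.n, 2 * k), (Label.s, k)} (1 / 2)
        + datum {(Label.s, 2 * k), (Label.n, k)} (1 / 2)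

/-- One step of the Markov process: in each type sequence all factors evolve independently, and
the outcome is weighted by the weight of the type sequence. -/
def markovStep (D : Data) : Data :=
  ∑ t ∈ D.coeff.support, D.coeff t • (t.map transition).prod

/-- The cycle data of a collection of data: forget the types and keep the lengths, adding the
weights of all type sequences with the same lengths. -/
def cycleData (D : Data) : Set (Multiset ℕ × ℚ) :=
  {p | (∃ t ∈ D.coeff.support, t.map Prod.snd = p.1) ∧
    p.2 = ∑ t ∈ D.coeff.support with t.map Prod.snd = p.1, D.coeff t}

/-- The cycle data obtained by applying the Markov process `m` times to `(t, p)`. -/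
def markovCycleData (t : TypeSeq) (p : ℚ) (m : ℕ) : Set (Multiset ℕ × ℚ) :=
  cycleData (markovStep^[m] (datum t p))

/-- `A_1^{(n)}`: the Markov process applied `n - 1` times to `([s,1]³, 1/12)`. -/
def A₁ (n : ℕ) : Set (Multiset ℕ × ℚ) :=
  markovCycleData {(Label.s, 1), (Label.s, 1), (Label.s, 1)} (1 / 12) (n - 1)

/-- `A_2^{(n)}`: the Markov process applied `n - 1` times to `([s,3], 2/3)`. -/
def A₂ (n : ℕ) : Set (Multiset ℕ × ℚ) :=
  markovCycleData {(Label.s, 3)} (2 / 3) (n - 1)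

/-- `A_3^{(n)}`: the Markov process applied `n - 1` times to `([n,1]²[s,1], 1/4)`. -/
def A₃ (n : ℕ) : Set (Multiset ℕ × ℚ) :=
  markovCycleData {(Label.n, 1), (Label.n, 1), (Label.s, 1)} (1 / 4) (n - 1)

/-- `A_4^{(n)}`: the Markov process applied `n - 1` times to `([n,1], 1/2)`. -/
def A₄ (n : ℕ) : Set (Multiset ℕ × ℚ) :=
  markovCycleData {(Label.n, 1)} (1 / 2) (n - 1)

/-! ### The groups consist of tree automorphisms -/

theorem extend_mem_treeAut {n : ℕ} (s : Word n → Equiv.Perm (Fin 3)) {σ : Equiv.Perm (Word n)}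
    (hσ : σ ∈ treeAut n) : extend s σ ∈ treeAut (n + 1) := by
  intro k u v
  have key := hσ k (Fin.init u) (Fin.init v)
  have full := hσ n (Fin.init u) (Fin.init v)
  have hinit : (∀ i : Fin n, i.val < n → Fin.init u i = Fin.init v i) →
      (Fin.init u : Word n) = Fin.init v := fun h => funext fun i => h i i.isLt
  constructor
  · intro h
    have h1 : ∀ i : Fin n, i.val < k → u i.castSucc = v i.castSucc := by
      refine key.1 fun i hi => ?_
      have := h i.castSucc (by simpa using hi)
      simpa [extend] using this
    intro i
    refine Fin.lastCases (fun hl => ?_) (fun j hj => h1 j (by simpa using hj)) i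
    have hk : n < k := by simpa using hl
    have e : (Fin.init u : Word n) = Fin.init v :=
      hinit fun i _ => h1 i (i.isLt.trans hk)
    have := h (Fin.last n) hl
    simpa [extend, e] using this
  · intro h
    have h1 : ∀ i : Fin n, i.val < k → σ (Fin.init u) i = σ (Fin.init v) i :=
      key.2 fun i hi => h i.castSucc (by simpa using hi)
    intro i
    refine Fin.lastCases (fun hl => ?_) (fun j hj => ?_) i
    · have hk : n < k := by simpa using hl
      have e : (Fin.init u : Word n) = Fin.init v :=
        hinit fun i _ => h i.castSucc (by simpa using i.isLt.trans hk)
      simp [extend, e, h (Fin.last n) hl]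
    · simpa [extend] using h1 j (by simpa using hj)

theorem embed_mem_treeAut {n : ℕ} {σ : Equiv.Perm (Word n)}
    (hσ : σ ∈ treeAut n) : embed σ ∈ treeAut (n + 1) := by
  intro k u v
  rcases k with _ | k
  · simp
  have key := hσ k (Fin.tail u) (Fin.tail v)
  simp only [Fin.forall_fin_succ (n := n), Fin.val_zero, Fin.val_succ, Nat.succ_lt_succ_iff,
    Nat.succ_pos, forall_const]
  by_cases hu : u 0 = 0 <;> by_cases hv : v 0 = 0
  · simpa [embed, hu, hv, Fin.tail] using key
  · simp [embed, hu, hv, Ne.symm hv]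
  · simp [embed, hu, hv]
  · simp [embed, hu, hv]

theorem level1_mem_treeAut (π : Equiv.Perm (Fin 3)) : level1 π ∈ treeAut 1 := by
  intro k u v
  simp [level1, Equiv.permCongr_apply]

theorem x_mem_treeAut : ∀ n, x n ∈ treeAut n
  | 0 => one_mem _
  | 1 => level1_mem_treeAut _
  | n + 2 => extend_mem_treeAut _ (x_mem_treeAut (n + 1))

theorem y_mem_treeAut : ∀ n, y n ∈ treeAut n
  | 0 => one_mem _
  | 1 => level1_mem_treeAut _
  | n + 2 => extend_mem_treeAut _ (y_mem_treeAut (n + 1))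

theorem z_mem_treeAut : ∀ n, z n ∈ treeAut n
  | 0 => one_mem _
  | 1 => one_mem _
  | n + 2 => extend_mem_treeAut _ (z_mem_treeAut (n + 1))

theorem L_le_treeAut : ∀ n, L n ≤ treeAut n
  | 0 => bot_le
  | n + 1 => by
    rw [L, Subgroup.closure_le]
    rintro g ((rfl | rfl) | ⟨σ, hσ, rfl⟩)
    · exact x_mem_treeAut _
    · exact z_mem_treeAut _
    · exact embed_mem_treeAut (L_le_treeAut n hσ)

theorem M_le_treeAut : ∀ n, M n ≤ treeAut n
  | 0 => bot_le
  | n + 1 => by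
    rw [M, Subgroup.closure_le]
    rintro g ((rfl | rfl | rfl) | ⟨σ, hσ, rfl⟩)
    · exact x_mem_treeAut _
    · exact y_mem_treeAut _
    · exact z_mem_treeAut _
    · exact embed_mem_treeAut (L_le_treeAut n hσ)

end

end CubicMarkov

open CubicMarkov

namespace CubicMarkov

noncomputable section

open AddMonoidAlgebra (single)
open Function (minimalPeriod)

/-! Both sides are generating functions in a monoid algebra of multisets of lengths, and both
satisfy the same recursion in the height of the tree.

On the Markov side, independence of the members makes one step an algebra homomorphism, and
homogeneity of the transitions in the length reduces `[t, k]` to `[t, 1]`. Conditioning on the first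
step then gives `law_s_succ` and `law_n_succ`, a closed recursion for the laws of `[s, 1]` and `[n,
1]`.

On the group side, an automorphism is split at the root into a permutation `π` of the first letter
and three sections (`wreath`). Call it even or odd when `π` has sign `e` and the parities of the
sections, defined recursively, multiply to the same `e` (`parityClass`). The recursions `x_succ`,
`y_succ`, `z_succ` show that `x` is even, `y` is odd, and `z` is even with section parities `(-1,
-1, 1)`. By induction `L` is the group of all even automorphisms, `M` the group of all even and odd
ones, `H` the group with `π = 1` and three even sections, and `K` the even automorphisms with `π =
1` (`L_eq`, `M_eq`, `H_eq`, `K_eq`). All cosets in (i)-(iii) are therefore unions of blocks, a block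
being given by `π` and the parities of the sections.

The cycle type of `wreath f π` comes from the first-return maps on the `π`-orbits: three independent
factors for `π = 1`, one factor with lengths tripled for a 3-cycle, one doubled factor and one
unchanged factor for a transposition. An even class has twelve blocks: one with `π = 1` and even
sections, three with `π = 1` and two odd sections, eight with a 3-cycle. These are the weights 1/12,
1/4, 2/3 of `[s, k]`. Among the twelve odd blocks, the fixed letter has an even section in one half
and an odd one in the other, which gives the weights 1/2 of `[n, k]`. Hence `genFun_parityFinset`:
even elements follow the law of `[s, 1]` and odd ones that of `[n, 1]`. Items (i)-(iii) select the
corresponding terms of the even recursion, and (iv) is the odd half of `M`. -/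

/-- Collections of cycle types with weights. -/
abbrev LengthData : Type := AddMonoidAlgebra ℚ (Multiset ℕ)

/-! ### The Markov process in the monoid algebra, and its first-step recursion. -/

/-- One step of the Markov process, as an algebra homomorphism. -/
def markovHom : Data →ₐ[ℚ] Data :=
  AddMonoidAlgebra.lift ℚ Data TypeSeq
    { toFun := fun t => (t.toAdd.map transition).prod
      map_one' := by simp
      map_mul' := by intro s t; simp }

/-- Forgetting the types and keeping the lengths. -/
def forget : Data →ₐ[ℚ] LengthData :=
  AddMonoidAlgebra.mapDomainAlgHom ℚ ℚ (Multiset.mapAddMonoidHom Prod.snd)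

/-- Multiplying all lengths by `k`. -/
def scaleTypes (k : ℕ) : Data →ₐ[ℚ] Data :=
  AddMonoidAlgebra.mapDomainAlgHom ℚ ℚ (Multiset.mapAddMonoidHom (Prod.map id (k * ·)))

/-- Multiplying all lengths by `k`. -/
def scale (k : ℕ) : LengthData →ₐ[ℚ] LengthData :=
  AddMonoidAlgebra.mapDomainAlgHom ℚ ℚ (Multiset.mapAddMonoidHom (k * ·))

/-- The total weight. -/
def totalWeight : LengthData →ₐ[ℚ] ℚ :=
  AddMonoidAlgebra.lift ℚ ℚ (Multiset ℕ) 1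

@[simp] theorem markovHom_single (t : TypeSeq) (q : ℚ) :
    markovHom (single t q) = q • (t.map transition).prod := by
  rw [markovHom, AddMonoidAlgebra.lift_single]
  rfl

@[simp] theorem forget_single (t : TypeSeq) (q : ℚ) :
    forget (single t q) = single (t.map Prod.snd) q := by
  simp [forget]

@[simp] theorem scaleTypes_single (k : ℕ) (t : TypeSeq) (q : ℚ) :
    scaleTypes k (single t q) = single (t.map (Prod.map id (k * ·))) q := by
  simp [scaleTypes]

@[simp] theorem scale_single (k : ℕ) (t : Multiset ℕ) (q : ℚ) :
    scale k (single t q) = single (t.map (k * ·)) q := by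
  simp [scale]

@[simp] theorem totalWeight_single (t : Multiset ℕ) (q : ℚ) : totalWeight (single t q) = q := by
  simp [totalWeight]

theorem markovStep_eq_markovHom : markovStep = markovHom := by
  funext D
  rw [markovStep, markovHom, AddMonoidAlgebra.lift_apply]
  rfl

/-- Transitions are homogeneous in the length. This is what lets a factor `[t, k]` be treated as a
rescaled `[t, 1]`. -/
theorem transition_mul (k : ℕ) (t : Label) (j : ℕ) :
    transition (t, k * j) = scaleTypes k (transition (t, j)) := by
  cases t <;> simp [transition, datum, mul_left_comm]

theorem markovHom_comp_scaleTypes (k : ℕ) :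
    markovHom.comp (scaleTypes k) = (scaleTypes k).comp markovHom := by
  refine AddMonoidAlgebra.algHom_ext (fun t => ?_) (Subsingleton.elim _ _)
  simp only [AlgHom.comp_apply, scaleTypes_single, markovHom_single, one_smul, map_multiset_prod,
    Multiset.map_map]
  congr 1
  refine Multiset.map_congr rfl fun p _ => ?_
  exact transition_mul k p.1 p.2

theorem iterate_markovHom_scaleTypes (k m : ℕ) (D : Data) :
    markovHom^[m] (scaleTypes k D) = scaleTypes k (markovHom^[m] D) := by
  refine Function.Commute.iterate_left (f := markovHom) (g := scaleTypes k) ?_ m D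
  exact fun D => DFunLike.congr_fun (markovHom_comp_scaleTypes k) D

theorem forget_scaleTypes (k : ℕ) (D : Data) : forget (scaleTypes k D) = scale k (forget D) := by
  have h : forget.comp (scaleTypes k) = (scale k).comp forget := by
    refine AddMonoidAlgebra.algHom_ext (fun t => ?_) (Subsingleton.elim _ _)
    simp
  exact DFunLike.congr_fun h D

/-- The distribution of lengths after `m` steps. -/
def evolve (m : ℕ) : Data →ₐ[ℚ] LengthData := forget.comp (markovHom ^ m)

theorem evolve_apply (m : ℕ) (D : Data) : evolve m D = forget (markovStep^[m] D) := by
  rw [markovStep_eq_markovHom, evolve, AlgHom.comp_apply, ← AlgHom.coe_pow]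

/-- The first step is split off, not the last: this matches the decomposition of a tree automorphism
at the root. -/
theorem evolve_succ (m : ℕ) (D : Data) : evolve (m + 1) D = evolve m (markovHom D) := by
  simp [evolve_apply, markovStep_eq_markovHom]

/-- The distribution of lengths after `m` steps starting at `[t, 1]`. -/
def law (t : Label) (m : ℕ) : LengthData := evolve m (single {(t, 1)} 1)

theorem evolve_single_singleton (t : Label) (k m : ℕ) :
    evolve m (single {(t, k)} 1) = scale k (law t m) := by
  have h : (single {(t, k)} 1 : Data) = scaleTypes k (single {(t, 1)} 1) := by simp
  rw [law, evolve_apply, evolve_apply, markovStep_eq_markovHom, h, iterate_markovHom_scaleTypes,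
    forget_scaleTypes]

theorem evolve_datum_singleton (t : Label) (k m : ℕ) (q : ℚ) :
    evolve m (datum {(t, k)} q) = q • scale k (law t m) := by
  rw [← evolve_single_singleton, ← map_smul, datum, AddMonoidAlgebra.smul_single, smul_eq_mul,
    mul_one]

theorem evolve_datum_pair (t u : Label) (j k m : ℕ) (q : ℚ) :
    evolve m (datum {(t, j), (u, k)} q) = q • (scale j (law t m) * scale k (law u m)) := by
  rw [← evolve_single_singleton, ← evolve_single_singleton, ← map_mul, ← map_smul, datum,
    AddMonoidAlgebra.single_mul_single, AddMonoidAlgebra.smul_single]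
  simp [← Multiset.singleton_add]

theorem evolve_datum_triple (t u v : Label) (i j k m : ℕ) (q : ℚ) :
    evolve m (datum {(t, i), (u, j), (v, k)} q) =
      q • (scale i (law t m) * (scale j (law u m) * scale k (law v m))) := by
  rw [← evolve_single_singleton, ← evolve_single_singleton, ← evolve_single_singleton,
    ← map_mul, ← map_mul, ← map_smul, datum,
    AddMonoidAlgebra.single_mul_single, AddMonoidAlgebra.single_mul_single,
    AddMonoidAlgebra.smul_single]
  simp [← Multiset.singleton_add]

theorem scale_one (D : LengthData) : scale 1 D = D := by
  have h : scale 1 = AlgHom.id ℚ LengthData := by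
    refine AddMonoidAlgebra.algHom_ext (fun t => ?_) (Subsingleton.elim _ _)
    simp
  rw [h, AlgHom.id_apply]

theorem totalWeight_scale (k : ℕ) (D : LengthData) : totalWeight (scale k D) = totalWeight D := by
  have h : totalWeight.comp (scale k) = totalWeight := by
    refine AddMonoidAlgebra.algHom_ext (fun t => ?_) (Subsingleton.elim _ _)
    simp
  exact DFunLike.congr_fun h D

theorem law_zero (t : Label) : law t 0 = single {1} 1 := by
  simp [law, evolve]

theorem law_s_succ (m : ℕ) :
    law Label.s (m + 1) = (2 / 3 : ℚ) • scale 3 (law Label.s m)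
      + (1 / 12 : ℚ) • (law Label.s m) ^ 3
      + (1 / 4 : ℚ) • (law Label.s m * law Label.n m ^ 2) := by
  rw [law, evolve_succ, markovHom_single, one_smul, Multiset.map_singleton,
    Multiset.prod_singleton, transition, map_add, map_add, evolve_datum_singleton,
    evolve_datum_triple, evolve_datum_triple, scale_one, scale_one, mul_one, pow_two, pow_three]

theorem law_n_succ (m : ℕ) :
    law Label.n (m + 1) = (1 / 2 : ℚ) • (scale 2 (law Label.n m) * law Label.s m)
      + (1 / 2 : ℚ) • (scale 2 (law Label.s m) * law Label.n m) := by
  rw [law, evolve_succ, markovHom_single, one_smul, Multiset.map_singleton,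
    Multiset.prod_singleton, transition, map_add, evolve_datum_pair, evolve_datum_pair, scale_one,
    scale_one, mul_one]

/-- Knowing the total mass later turns a mere proportionality between a generating function and a
law into an equality with the right constant. -/
theorem totalWeight_law (t : Label) (m : ℕ) : totalWeight (law t m) = 1 := by
  induction m generalizing t with
  | zero => simp [law_zero]
  | succ m ih =>
    cases t
    · rw [law_s_succ]; simp [totalWeight_scale, ih]; norm_num
    · rw [law_n_succ]; simp [totalWeight_scale, ih]; norm_num

/-! ### Cycle data in terms of coefficients -/

/-- The nonzero coefficients of a collection of cycle types with weights. -/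
def coeffSet (D : LengthData) : Set (Multiset ℕ × ℚ) :=
  {p | D.coeff p.1 ≠ 0 ∧ p.2 = D.coeff p.1}

theorem coeff_forget (D : Data) (c : Multiset ℕ) :
    (forget D).coeff c = ∑ t ∈ D.coeff.support with t.map Prod.snd = c, D.coeff t := by
  classical
  have h : (forget D).coeff = Finsupp.mapDomain (Multiset.map Prod.snd) D.coeff := rfl
  rw [h, Finsupp.mapDomain, Finsupp.sum_apply, Finsupp.sum, Finset.sum_filter]
  exact Finset.sum_congr rfl fun t _ => Finsupp.single_apply

/-- Nonnegativity excludes cancellation: a length multiset occurs in the support exactly when its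
total weight is nonzero. -/
theorem cycleData_eq_coeffSet {D : Data} (hD : ∀ t, 0 ≤ D.coeff t) :
    cycleData D = coeffSet (forget D) := by
  ext ⟨c, q⟩
  simp only [cycleData, coeffSet, Set.mem_ofPred_eq, coeff_forget]
  refine and_congr_left fun _ => ?_
  rw [Ne, Finset.sum_eq_zero_iff_of_nonneg fun t _ => hD t]
  simp only [Finset.mem_filter, Finsupp.mem_support_iff]
  push Not
  exact exists_congr fun t => ⟨fun h => ⟨⟨h.1, h.2⟩, h.1⟩, fun h => h.1⟩

theorem nonneg_mul {D E : Data} (hD : ∀ t, 0 ≤ D.coeff t) (hE : ∀ t, 0 ≤ E.coeff t) (t : TypeSeq) :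
    0 ≤ (D * E).coeff t := by
  classical
  rw [AddMonoidAlgebra.coeff_mul]
  refine Finset.sum_nonneg fun a _ => Finset.sum_nonneg fun b _ => ?_
  beta_reduce
  split_ifs
  · exact mul_nonneg (hD a) (hE b)
  · exact le_rfl

theorem nonneg_single (t : TypeSeq) {q : ℚ} (hq : 0 ≤ q) (u : TypeSeq) :
    0 ≤ (single t q : Data).coeff u := by
  classical
  rw [AddMonoidAlgebra.coeff_single, Finsupp.single_apply]
  split_ifs
  · exact hq
  · exact le_rfl

theorem nonneg_transition (p : Label × ℕ) (t : TypeSeq) : 0 ≤ (transition p).coeff t := by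
  obtain ⟨_ | _, k⟩ := p
  · exact add_nonneg (add_nonneg (nonneg_single _ (by norm_num) _) (nonneg_single _ (by norm_num) _))
      (nonneg_single _ (by norm_num) _)
  · exact add_nonneg (nonneg_single _ (by norm_num) _) (nonneg_single _ (by norm_num) _)

theorem nonneg_prod_transition (u t : TypeSeq) : 0 ≤ ((u.map transition).prod : Data).coeff t := by
  induction u using Multiset.induction_on generalizing t with
  | empty => exact nonneg_single 0 zero_le_one t
  | cons a u ih =>
    rw [Multiset.map_cons, Multiset.prod_cons]
    exact nonneg_mul (nonneg_transition a) ih t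

theorem nonneg_markovStep {D : Data} (hD : ∀ t, 0 ≤ D.coeff t) (t : TypeSeq) :
    0 ≤ (markovStep D).coeff t := by
  rw [markovStep, AddMonoidAlgebra.coeff_sum, Finset.sum_apply']
  exact Finset.sum_nonneg fun u _ => mul_nonneg (hD u) (nonneg_prod_transition u t)

theorem markovCycleData_eq_coeffSet (t : TypeSeq) {q : ℚ} (hq : 0 ≤ q) (m : ℕ) :
    markovCycleData t q m = coeffSet (evolve m (datum t q)) := by
  rw [markovCycleData, evolve_apply]
  refine cycleData_eq_coeffSet ?_
  induction m with
  | zero => exact nonneg_single t hq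
  | succ m ih =>
    rw [Function.iterate_succ_apply']
    exact nonneg_markovStep ih

theorem A₁_eq (m : ℕ) : A₁ (m + 1) = coeffSet ((1 / 12 : ℚ) • (law Label.s m) ^ 3) := by
  rw [A₁, markovCycleData_eq_coeffSet _ (by norm_num), Nat.add_sub_cancel, evolve_datum_triple,
    scale_one, pow_three]

theorem A₂_eq (m : ℕ) : A₂ (m + 1) = coeffSet ((2 / 3 : ℚ) • scale 3 (law Label.s m)) := by
  rw [A₂, markovCycleData_eq_coeffSet _ (by norm_num), Nat.add_sub_cancel, evolve_datum_singleton]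

theorem A₃_eq (m : ℕ) :
    A₃ (m + 1) = coeffSet ((1 / 4 : ℚ) • (law Label.n m ^ 2 * law Label.s m)) := by
  rw [A₃, markovCycleData_eq_coeffSet _ (by norm_num), Nat.add_sub_cancel, evolve_datum_triple,
    scale_one, scale_one, pow_two, mul_assoc]

theorem A₄_eq (m : ℕ) : A₄ (m + 1) = coeffSet ((1 / 2 : ℚ) • law Label.n m) := by
  rw [A₄, markovCycleData_eq_coeffSet _ (by norm_num), Nat.add_sub_cancel, evolve_datum_singleton,
    scale_one]

/-! ### Generating functions of cycle types -/

/-- The sum of the cycle types of the elements of a finite set of permutations. -/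
def genFun {n : ℕ} (S : Finset (Equiv.Perm (Word n))) : LengthData :=
  ∑ σ ∈ S, single (cycleLengths σ) 1

theorem totalWeight_genFun {n : ℕ} (S : Finset (Equiv.Perm (Word n))) :
    totalWeight (genFun S) = S.card := by
  simp [genFun]

theorem coeff_genFun {n : ℕ} (S : Finset (Equiv.Perm (Word n))) (c : Multiset ℕ) :
    (genFun S).coeff c = ({σ ∈ S | cycleLengths σ = c}.card : ℚ) := by
  classical
  simp [genFun, AddMonoidAlgebra.coeff_sum, Finset.sum_apply', Finsupp.single_apply]

/-- The factor `|S₁|` cancels between the proportion and the index, so only the number of elements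
of each cycle type, divided by `|S₂|`, remains. -/
theorem CD_eq_coeffSet {n : ℕ} {S₁ S₂ : Finset (Equiv.Perm (Word n))} (h₁ : S₁.Nonempty)
    (h₂ : S₂.Nonempty) :
    CD n S₁ S₂ = coeffSet ((1 / (S₂.card : ℚ)) • genFun S₁) := by
  have e₁ : (S₁.card : ℚ) ≠ 0 := by exact_mod_cast h₁.card_ne_zero
  have e₂ : (S₂.card : ℚ) ≠ 0 := by exact_mod_cast h₂.card_ne_zero
  ext ⟨c, q⟩
  have hf : {σ ∈ (S₁ : Set (Equiv.Perm (Word n))) | cycleLengths σ = c} =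
      ({σ ∈ S₁ | cycleLengths σ = c} : Finset _) := by ext; simp
  simp only [CD, coeffSet, Set.mem_ofPred_eq, AddMonoidAlgebra.coeff_smul_apply, coeff_genFun, hf,
    Set.ncard_coe_finset, smul_eq_mul]
  refine and_congr ?_ ?_
  · simp [e₂, Finset.filter_eq_empty_iff]
  · rw [div_mul_div_cancel₀ e₁, div_mul_eq_mul_div, one_mul]

/-! ### Cycle types and minimal periods -/

theorem isPeriodicPt_perm {α : Type*} (σ : Equiv.Perm α) (m : ℕ) (v : α) :
    Function.IsPeriodicPt σ m v ↔ (σ ^ m) v = v := by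
  rw [Function.IsPeriodicPt, Function.IsFixedPt, Equiv.Perm.iterate_eq_pow]

theorem minimalPeriod_perm_pos {α : Type*} [Fintype α] [DecidableEq α] (σ : Equiv.Perm α) (v : α) :
    0 < minimalPeriod σ v :=
  Function.IsPeriodicPt.minimalPeriod_pos (orderOf_pos σ)
    ((isPeriodicPt_perm σ _ v).2 (by rw [pow_orderOf_eq_one, Equiv.Perm.one_apply]))

/-- A power of a cycle is trivial as soon as it fixes one point of the support, so the period and
the order of the cycle have the same multiples. -/
theorem minimalPeriod_eq_card_support_cycleOf {α : Type*} [Fintype α] [DecidableEq α]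
    (σ : Equiv.Perm α) {v : α} (hv : σ v ≠ v) :
    minimalPeriod σ v = (σ.cycleOf v).support.card := by
  have hc := σ.isCycle_cycleOf hv
  rw [← hc.orderOf]
  refine Nat.dvd_right_iff_eq.1 fun m => ?_
  rw [← Function.isPeriodicPt_iff_minimalPeriod_dvd, isPeriodicPt_perm, orderOf_dvd_iff_pow_eq_one,
    hc.pow_eq_one_iff' (x := v) (by rwa [Equiv.Perm.cycleOf_apply_self]),
    Equiv.Perm.cycleOf_pow_apply_self]

/-- Fixed points are absent from `cycleType` and enter `partition` as added ones, hence the separate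
case `k < 2`. For `k ≥ 2` the points of period `k` are fibred over the cycles of length `k`, each
fibre being the support of its cycle. -/
theorem count_parts_partition {α : Type*} [Fintype α] [DecidableEq α] (σ : Equiv.Perm α) (k : ℕ) :
    k * σ.partition.parts.count k = ({v | minimalPeriod σ v = k} : Finset α).card := by
  rw [Equiv.Perm.parts_partition, Multiset.count_add]
  rcases Nat.lt_or_ge k 2 with hk | hk
  · have h0 : σ.cycleType.count k = 0 :=
      Multiset.count_eq_zero.2 fun h => absurd (Equiv.Perm.two_le_of_mem_cycleType h) (by omega)
    rw [h0, zero_add]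
    interval_cases k
    · simp [(minimalPeriod_perm_pos σ _).ne']
    · rw [Multiset.count_replicate_self, one_mul, ← Finset.card_compl]
      congr 1
      ext v
      simp [Function.minimalPeriod_eq_one_iff_isFixedPt, Function.IsFixedPt]
  · have h1 : (Multiset.replicate (Fintype.card α - σ.support.card) 1).count k = 0 :=
      Multiset.count_eq_zero.2 fun h => absurd (Multiset.eq_of_mem_replicate h) (by omega)
    have hmoved : ∀ v, minimalPeriod σ v = k → σ v ≠ v := fun v hv h => by
      have := Function.minimalPeriod_eq_one_iff_isFixedPt.2 h
      omega
    rw [h1, add_zero, Equiv.Perm.cycleType_def, Multiset.count_map, ← Finset.filter_val,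
      Finset.card_val, Finset.card_eq_sum_card_fiberwise (f := σ.cycleOf)
        (t := {c ∈ σ.cycleFactorsFinset | k = c.support.card}), mul_comm, ← smul_eq_mul]
    · symm
      refine Finset.sum_eq_card_nsmul fun c hc => ?_
      rw [Finset.mem_filter] at hc
      rw [hc.2]
      congr 1
      ext v
      simp only [Finset.mem_filter, Finset.mem_univ, true_and]
      constructor
      · rintro ⟨h, rfl⟩
        rw [Equiv.Perm.mem_support, Equiv.Perm.cycleOf_apply_self]
        exact hmoved v (h.trans hc.2.symm)
      · intro hv
        have e := Equiv.Perm.cycle_is_cycleOf hv hc.1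
        refine ⟨?_, e.symm⟩
        have hm : σ v ≠ v := by
          rw [e, Equiv.Perm.mem_support, Equiv.Perm.cycleOf_apply_self] at hv
          exact hv
        rw [minimalPeriod_eq_card_support_cycleOf σ hm, ← e]
    · intro v hv
      simp only [Finset.coe_filter, Finset.mem_univ, true_and, Set.mem_ofPred_eq] at hv
      have hm := hmoved v hv
      simp only [Finset.coe_filter, Set.mem_ofPred_eq]
      exact ⟨Equiv.Perm.cycleOf_mem_cycleFactorsFinset_iff.2 (Equiv.Perm.mem_support.2 hm),
        by rw [← minimalPeriod_eq_card_support_cycleOf σ hm, hv]⟩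

/-- The number of points of period `k`. -/
def periodCount {n : ℕ} (σ : Equiv.Perm (Word n)) (k : ℕ) : ℕ :=
  ({v | minimalPeriod σ v = k} : Finset (Word n)).card

theorem mul_count_cycleLengths {n : ℕ} (σ : Equiv.Perm (Word n)) (k : ℕ) :
    k * (cycleLengths σ).count k = periodCount σ k := by
  rw [cycleLengths, periodCount, ← count_parts_partition]

theorem zero_notMem_cycleLengths {n : ℕ} (σ : Equiv.Perm (Word n)) : 0 ∉ cycleLengths σ :=
  fun h => (σ.partition.parts_pos h).ne' rfl

theorem multiset_eq_of_mul_count {s t : Multiset ℕ} (hs : 0 ∉ s) (ht : 0 ∉ t)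
    (h : ∀ k, k * s.count k = k * t.count k) : s = t := by
  ext k
  rcases Nat.eq_zero_or_pos k with rfl | hk
  · rw [Multiset.count_eq_zero.2 hs, Multiset.count_eq_zero.2 ht]
  · exact Nat.eq_of_mul_eq_mul_left hk (h k)

theorem cycleLengths_conj {n : ℕ} (σ τ : Equiv.Perm (Word n)) :
    cycleLengths (τ * σ * τ⁻¹) = cycleLengths σ := by
  rw [cycleLengths, cycleLengths,
    Equiv.Perm.partition_eq_of_isConj.1 (isConj_iff.2 ⟨τ, rfl⟩ : IsConj σ (τ * σ * τ⁻¹))]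

theorem periodCount_conj {n : ℕ} (σ τ : Equiv.Perm (Word n)) (k : ℕ) :
    periodCount (τ * σ * τ⁻¹) k = periodCount σ k := by
  rw [← mul_count_cycleLengths, cycleLengths_conj, mul_count_cycleLengths]

theorem periodCount_mul_comm {n : ℕ} (σ τ : Equiv.Perm (Word n)) (k : ℕ) :
    periodCount (σ * τ) k = periodCount (τ * σ) k := by
  rw [← periodCount_conj (σ * τ) τ]
  congr 1
  group

theorem mul_count_map_mul {r : ℕ} (hr : 0 < r) (s : Multiset ℕ) (k : ℕ) :
    k * (s.map (r * ·)).count k = if r ∣ k then r * (k / r * s.count (k / r)) else 0 := by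
  split_ifs with h
  · obtain ⟨j, rfl⟩ := h
    rw [Multiset.count_map_eq_count' _ _ (mul_right_injective₀ hr.ne'), Nat.mul_div_cancel_left _ hr,
      mul_assoc]
  · rw [Multiset.count_eq_zero.2, mul_zero]
    intro hk
    obtain ⟨j, -, rfl⟩ := Multiset.mem_map.1 hk
    exact h (dvd_mul_right _ _)

/-! ### The wreath decomposition -/

/-- The permutation `a w ↦ π(a) f_a(w)`. -/
def wreath {n : ℕ} (f : Fin 3 → Equiv.Perm (Word n)) (π : Equiv.Perm (Fin 3)) :
    Equiv.Perm (Word (n + 1)) where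
  toFun u := Fin.cons (π (u 0)) (f (u 0) (Fin.tail u))
  invFun u := Fin.cons (π.symm (u 0)) ((f (π.symm (u 0))).symm (Fin.tail u))
  left_inv u := by simp
  right_inv u := by simp

@[simp] theorem wreath_cons {n : ℕ} (f : Fin 3 → Equiv.Perm (Word n)) (π : Equiv.Perm (Fin 3))
    (a : Fin 3) (w : Word n) :
    wreath f π (Fin.cons a w : Word (n + 1)) = (Fin.cons (π a) (f a w) : Word (n + 1)) := by
  simp [wreath]

theorem perm_ext_cons {n : ℕ} {σ τ : Equiv.Perm (Word (n + 1))}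
    (h : ∀ (a : Fin 3) (w : Word n), σ (Fin.cons a w : Word (n + 1)) =
      τ (Fin.cons a w : Word (n + 1))) : σ = τ := by
  ext1 u
  rw [← Fin.cons_self_tail u]
  exact h _ _

theorem wreath_mul {n : ℕ} (f g : Fin 3 → Equiv.Perm (Word n)) (π ρ : Equiv.Perm (Fin 3)) :
    wreath f π * wreath g ρ = wreath (fun a => f (ρ a) * g a) (π * ρ) :=
  perm_ext_cons fun a w => by simp

theorem wreath_one {n : ℕ} : wreath (1 : Fin 3 → Equiv.Perm (Word n)) 1 = 1 :=
  perm_ext_cons fun a w => by simp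

theorem wreath_inv {n : ℕ} (f : Fin 3 → Equiv.Perm (Word n)) (π : Equiv.Perm (Fin 3)) :
    (wreath f π)⁻¹ = wreath (fun a => (f (π⁻¹ a))⁻¹) π⁻¹ := by
  rw [inv_eq_iff_mul_eq_one, wreath_mul]
  refine Eq.trans ?_ wreath_one
  congr 1
  · ext a; simp
  · simp

theorem wreath_injective {n : ℕ} {f g : Fin 3 → Equiv.Perm (Word n)} {π ρ : Equiv.Perm (Fin 3)}
    (h : wreath f π = wreath g ρ) : f = g ∧ π = ρ := by
  have key (a : Fin 3) (w : Word n) : π a = ρ a ∧ f a w = g a w := by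
    have := DFunLike.congr_fun h (Fin.cons a w : Word (n + 1))
    rw [wreath_cons, wreath_cons] at this
    exact ⟨(Fin.cons_inj.1 this).1, (Fin.cons_inj.1 this).2⟩
  exact ⟨funext fun a => Equiv.ext fun w => (key a w).2,
    Equiv.ext fun a => (key a fun _ => 0).1⟩

theorem wreath_pow_cons_zero {n : ℕ} (f : Fin 3 → Equiv.Perm (Word n)) (π : Equiv.Perm (Fin 3))
    (m : ℕ) (u : Word (n + 1)) : (wreath f π ^ m) u 0 = (π ^ m) (u 0) := by
  induction m with
  | zero => rfl
  | succ m ih => rw [pow_succ', pow_succ', Equiv.Perm.mul_apply, Equiv.Perm.mul_apply, ← ih]; rfl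

/-- If the first return of `a w` to the words beginning with `a` is `a g(w)`, after `r` steps, then
periods get multiplied by `r`. -/
theorem minimalPeriod_wreath {n : ℕ} {f : Fin 3 → Equiv.Perm (Word n)} {π : Equiv.Perm (Fin 3)}
    {a : Fin 3} {r : ℕ} {g : Equiv.Perm (Word n)} (hr : minimalPeriod π a = r)
    (h : ∀ w, (wreath f π ^ r) (Fin.cons a w : Word (n + 1)) = (Fin.cons a (g w) : Word (n + 1)))
    (w : Word n) :
    minimalPeriod (wreath f π) (Fin.cons a w : Word (n + 1)) = r * minimalPeriod g w := by
  have hpow (j : ℕ) : (wreath f π ^ (r * j)) (Fin.cons a w : Word (n + 1)) =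
      (Fin.cons a ((g ^ j) w) : Word (n + 1)) := by
    induction j with
    | zero => rfl
    | succ j ih =>
      rw [Nat.mul_succ, Nat.add_comm (r * j) r, pow_add, Equiv.Perm.mul_apply, ih, h, pow_succ',
        Equiv.Perm.mul_apply]
  refine Nat.dvd_right_iff_eq.1 fun m => ?_
  rw [← Function.isPeriodicPt_iff_minimalPeriod_dvd, isPeriodicPt_perm]
  constructor
  · intro hm
    -- A return to the same word is in particular a return to the first letter `a`, so its time is a
    -- multiple of `r`.
    have h0 := wreath_pow_cons_zero f π m (Fin.cons a w)
    rw [hm, Fin.cons_zero, eq_comm, ← isPeriodicPt_perm,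
      Function.isPeriodicPt_iff_minimalPeriod_dvd, hr] at h0
    obtain ⟨j, rfl⟩ := h0
    rw [hpow] at hm
    refine mul_dvd_mul_left r ?_
    rw [← Function.isPeriodicPt_iff_minimalPeriod_dvd, isPeriodicPt_perm]
    exact (Fin.cons_inj.1 hm).2
  · rintro ⟨j, rfl⟩
    rw [mul_assoc, hpow, (isPeriodicPt_perm g _ w).1
      (Function.isPeriodicPt_iff_minimalPeriod_dvd.2 (dvd_mul_right _ j))]

theorem periodCount_succ {n : ℕ} (σ : Equiv.Perm (Word (n + 1))) (k : ℕ) :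
    periodCount σ k =
      ∑ a, ({w | minimalPeriod σ (Fin.cons a w : Word (n + 1)) = k} : Finset (Word n)).card := by
  simp only [periodCount, Finset.card_filter]
  rw [← Fintype.sum_prod_type' (f := fun (a : Fin 3) (w : Word n) =>
    if minimalPeriod σ (Fin.cons a w : Word (n + 1)) = k then 1 else 0)]
  exact ((Fin.consEquiv fun _ => Fin 3).sum_comp _).symm

theorem card_minimalPeriod_wreath {n : ℕ} {f : Fin 3 → Equiv.Perm (Word n)}
    {π : Equiv.Perm (Fin 3)} {a : Fin 3} {r : ℕ} {g : Equiv.Perm (Word n)} (h0 : 0 < r)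
    (hr : minimalPeriod π a = r)
    (h : ∀ w, (wreath f π ^ r) (Fin.cons a w : Word (n + 1)) = (Fin.cons a (g w) : Word (n + 1)))
    (k : ℕ) :
    ({w | minimalPeriod (wreath f π) (Fin.cons a w : Word (n + 1)) = k} : Finset (Word n)).card =
      if r ∣ k then periodCount g (k / r) else 0 := by
  simp only [minimalPeriod_wreath hr h]
  split_ifs with hk
  · obtain ⟨j, rfl⟩ := hk
    rw [Nat.mul_div_cancel_left _ h0, periodCount]
    congr 1
    ext w
    simp [h0.ne']
  · rw [Finset.card_eq_zero, Finset.filter_eq_empty_iff]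
    rintro w - rfl
    exact hk (dvd_mul_right _ _)

theorem zero_notMem_map_mul {n : ℕ} {r : ℕ} (h0 : 0 < r) (σ : Equiv.Perm (Word n)) :
    0 ∉ (cycleLengths σ).map (r * ·) := by
  intro h
  obtain ⟨j, hj, e⟩ := Multiset.mem_map.1 h
  rcases Nat.mul_eq_zero.1 e with e | e
  · omega
  · exact zero_notMem_cycleLengths σ (e ▸ hj)

theorem cycleLengths_wreath_one {n : ℕ} (f : Fin 3 → Equiv.Perm (Word n)) :
    cycleLengths (wreath f 1) = cycleLengths (f 0) + cycleLengths (f 1) + cycleLengths (f 2) := by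
  refine multiset_eq_of_mul_count (zero_notMem_cycleLengths _) ?_ fun k => ?_
  · simp [Multiset.mem_add, zero_notMem_cycleLengths]
  · have hr (a : Fin 3) : minimalPeriod (1 : Equiv.Perm (Fin 3)) a = 1 :=
      Function.minimalPeriod_eq_one_iff_isFixedPt.2 rfl
    rw [mul_count_cycleLengths, periodCount_succ, Multiset.count_add, Multiset.count_add, mul_add,
      mul_add, mul_count_cycleLengths, mul_count_cycleLengths, mul_count_cycleLengths,
      Fin.sum_univ_three]
    have hc (a : Fin 3) := card_minimalPeriod_wreath (f := f) (π := 1) one_pos (hr a) (g := f a)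
      (fun w => by rw [pow_one, wreath_cons]; rfl) k
    simp [hc]

/-- Each first letter returns after three steps. The three return maps are cyclic rotations of one
product, hence conjugate, so each contributes equally many points of a given period. -/
theorem cycleLengths_wreath_three {n : ℕ} (f : Fin 3 → Equiv.Perm (Word n))
    {π : Equiv.Perm (Fin 3)} (h1 : Equiv.Perm.sign π = 1) (h2 : π ≠ 1) :
    cycleLengths (wreath f π) = (cycleLengths (f (π (π 0)) * f (π 0) * f 0)).map (3 * ·) := by
  have key : ∀ π : Equiv.Perm (Fin 3), Equiv.Perm.sign π = 1 → π ≠ 1 →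
      (∀ a, π a ≠ a ∧ π (π (π a)) = a) ∧
        (0 ≠ π 0 ∧ 0 ≠ π (π 0) ∧ π 0 ≠ π (π 0) ∧ Finset.univ = {0, π 0, π (π 0)}) := by decide
  obtain ⟨h3, e1, e2, e3, huniv⟩ := key π h1 h2
  have hr (a : Fin 3) : minimalPeriod π a = 3 :=
    have : Fact (Nat.Prime 3) := ⟨Nat.prime_three⟩
    Function.minimalPeriod_eq_prime (h3 a).2 (h3 a).1
  have hc (a : Fin 3) (k : ℕ) := card_minimalPeriod_wreath (f := f) (π := π) (a := a) three_pos (hr a)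
    (g := f (π (π a)) * f (π a) * f a) (fun w => by
      change wreath f π (wreath f π (wreath f π _)) = _
      rw [wreath_cons, wreath_cons, wreath_cons, (h3 a).2]
      rfl) k
  refine multiset_eq_of_mul_count (zero_notMem_cycleLengths _) (zero_notMem_map_mul three_pos _)
    fun k => ?_
  rw [mul_count_cycleLengths, periodCount_succ, mul_count_map_mul three_pos, mul_count_cycleLengths,
    huniv, Finset.sum_insert (by simp [e1, e2]), Finset.sum_insert (by simp [e3]),
    Finset.sum_singleton, hc, hc, hc, (h3 0).2]
  split_ifs
  -- The return maps at `π 0` and `π (π 0)` are rotated into the one at `0`.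
  · rw [mul_assoc (f 0) (f (π (π 0))), periodCount_mul_comm (f 0),
      periodCount_mul_comm (f (π 0) * f 0), ← mul_assoc]
    ring
  · rfl

/-- The letters 0 and 1 return after two steps by the conjugate products `f 1 * f 0` and `f 0 * f
1`; the letter 2 returns at once. -/
theorem cycleLengths_wreath_swap {n : ℕ} (f : Fin 3 → Equiv.Perm (Word n)) :
    cycleLengths (wreath f (Equiv.swap 0 1)) =
      (cycleLengths (f 1 * f 0)).map (2 * ·) + cycleLengths (f 2) := by
  have hr : ∀ a : Fin 3, a ≠ 2 → minimalPeriod (Equiv.swap (0 : Fin 3) 1) a = 2 := by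
    intro a ha
    have : Fact (Nat.Prime 2) := ⟨Nat.prime_two⟩
    refine Function.minimalPeriod_eq_prime ?_ ?_
    · change Equiv.swap (0 : Fin 3) 1 (Equiv.swap (0 : Fin 3) 1 a) = a
      revert a; decide
    · change ¬Equiv.swap (0 : Fin 3) 1 a = a
      revert a; decide
  have h0 (k : ℕ) := card_minimalPeriod_wreath (f := f) two_pos (hr 0 (by decide))
    (g := f 1 * f 0) (fun w => by
      change wreath f _ (wreath f _ _) = _
      rw [wreath_cons, wreath_cons]
      rfl) k
  have h1 (k : ℕ) := card_minimalPeriod_wreath (f := f) two_pos (hr 1 (by decide))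
    (g := f 0 * f 1) (fun w => by
      change wreath f _ (wreath f _ _) = _
      rw [wreath_cons, wreath_cons]
      rfl) k
  have h2 (k : ℕ) := card_minimalPeriod_wreath (f := f) (a := 2) (π := Equiv.swap 0 1) one_pos
    (Function.minimalPeriod_eq_one_iff_isFixedPt.2 (by decide))
    (g := f 2) (fun w => by rw [pow_one, wreath_cons]; rfl) k
  refine multiset_eq_of_mul_count (zero_notMem_cycleLengths _) ?_ fun k => ?_
  · simp only [Multiset.mem_add, zero_notMem_cycleLengths, zero_notMem_map_mul two_pos, or_self,
      not_false_eq_true]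
  rw [mul_count_cycleLengths, periodCount_succ, Multiset.count_add, mul_add,
    mul_count_map_mul two_pos, mul_count_cycleLengths, mul_count_cycleLengths, Fin.sum_univ_three,
    h0, h1, h2, periodCount_mul_comm (f 0)]
  split_ifs <;> simp_all [two_mul]

/-! ### Wreath recursion of the generators -/

/-- `a` is the largest element of its `π`-orbit. -/
def IsTop (π : Equiv.Perm (Fin 3)) (a : Fin 3) : Prop := π a ≤ a ∧ π (π a) ≤ a

instance (π : Equiv.Perm (Fin 3)) (a : Fin 3) : Decidable (IsTop π a) := by
  unfold IsTop; infer_instance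

/-- `G` acts on the first letter by `π`, and its first return to the words that begin with `a` is
the typed permutation `t a`, applied when the first letter is the largest one of its orbit. -/
structure IsBlock {n : ℕ} (π : Equiv.Perm (Fin 3)) (t : Fin 3 → Typed n) (G : Typed (n + 1)) :
    Prop where
  t_perm : ∀ a, t (π a) = t a
  perm_cons : ∀ (a : Fin 3) (w : Word n), G.perm (Fin.cons a w : Word (n + 1)) =
    (Fin.cons (π a) (if IsTop π a then (t a).perm w else w) : Word (n + 1))
  label_cons : ∀ (a : Fin 3) (w : Word n), G.label (Fin.cons a w : Word (n + 1)) = (t a).label w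

theorem sameCycle_of_apply_eq {α : Type*} {σ : Equiv.Perm α} {u v : α} (h : σ u = v) :
    σ.SameCycle u v :=
  ⟨1, by rw [zpow_one, h]⟩

theorem toLex_cons_le {n : ℕ} (a b : Fin 3) (v w : Word n) :
    toLex (Fin.cons b v : Word (n + 1)) ≤ toLex (Fin.cons a w : Word (n + 1)) ↔
      b < a ∨ b = a ∧ toLex v ≤ toLex w := by
  have hlt : toLex (Fin.cons b v : Word (n + 1)) < toLex (Fin.cons a w : Word (n + 1)) ↔
      b < a ∨ b = a ∧ toLex v < toLex w :=
    Fin.pi_lex_lt_cons_cons (α := fun _ => Fin 3) (s := fun {_} => (· < ·))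
  refine (le_iff_lt_or_eq.trans (or_congr hlt (toLex.injective.eq_iff.trans Fin.cons_inj))).trans ?_
  rw [le_iff_lt_or_eq, toLex.injective.eq_iff]
  tauto

namespace IsBlock

variable {n : ℕ} {π : Equiv.Perm (Fin 3)} {t : Fin 3 → Typed n} {G : Typed (n + 1)}

/-- Below the largest letter of its orbit `G` moves only the first letter, so the tail is carried
unchanged up to that letter. -/
theorem exists_top (h : IsBlock π t G) (a : Fin 3) :
    ∃ m, IsTop π m ∧ (m = a ∨ m = π a ∨ m = π (π a)) ∧
      ∀ w : Word n, G.perm.SameCycle (Fin.cons a w : Word (n + 1))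
        (Fin.cons m w : Word (n + 1)) := by
  have key : ∀ (π : Equiv.Perm (Fin 3)) (a : Fin 3), ¬IsTop π a → ¬IsTop π (π a) →
      IsTop π (π (π a)) := by decide
  have hstep (b : Fin 3) (hb : ¬IsTop π b) (w : Word n) :
      G.perm.SameCycle (Fin.cons b w : Word (n + 1)) (Fin.cons (π b) w : Word (n + 1)) :=
    sameCycle_of_apply_eq (by rw [h.perm_cons, if_neg hb])
  by_cases h0 : IsTop π a
  · exact ⟨a, h0, Or.inl rfl, fun w => Equiv.Perm.SameCycle.refl _ _⟩
  by_cases h1 : IsTop π (π a)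
  · exact ⟨π a, h1, Or.inr (Or.inl rfl), hstep a h0⟩
  · exact ⟨π (π a), key π a h0 h1, Or.inr (Or.inr rfl),
      fun w => (hstep a h0 w).trans (hstep (π a) h1 w)⟩

theorem sameCycle_of_top (h : IsBlock π t G) {a : Fin 3} (ha : IsTop π a) {v w : Word n}
    (hvw : (t a).perm.SameCycle w v) :
    G.perm.SameCycle (Fin.cons a w : Word (n + 1)) (Fin.cons a v : Word (n + 1)) := by
  -- An orbit has a single largest letter, so a full turn starting at the top comes back to it.
  have key : ∀ (π : Equiv.Perm (Fin 3)) (a m : Fin 3), IsTop π a → IsTop π m →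
      (m = π a ∨ m = π (π a) ∨ m = π (π (π a))) → m = a := by decide
  have hstep (w : Word n) : G.perm.SameCycle (Fin.cons a w : Word (n + 1))
      (Fin.cons a ((t a).perm w) : Word (n + 1)) := by
    obtain ⟨m, hm, hma, hs⟩ := h.exists_top (π a)
    obtain rfl := key π a m ha hm hma
    refine (sameCycle_of_apply_eq ?_).trans (hs _)
    rw [h.perm_cons, if_pos ha]
  obtain ⟨k, -, -, rfl⟩ := hvw.exists_pow_eq _
  clear hvw
  induction k with
  | zero => exact Equiv.Perm.SameCycle.refl _ _
  | succ k ih =>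
    rw [pow_succ', Equiv.Perm.mul_apply]
    exact ih.trans (hstep _)

theorem of_sameCycle (h : IsBlock π t G) {a b : Fin 3} {v w : Word n}
    (hs : G.perm.SameCycle (Fin.cons a w : Word (n + 1)) (Fin.cons b v : Word (n + 1))) :
    (b = a ∨ b = π a ∨ b = π (π a)) ∧ (t a).perm.SameCycle w v := by
  have key : ∀ (π : Equiv.Perm (Fin 3)) (a b : Fin 3), (b = a ∨ b = π a ∨ b = π (π a)) →
      (π b = a ∨ π b = π a ∨ π b = π (π a)) := by decide
  obtain ⟨k, -, -, hk⟩ := hs.exists_pow_eq _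
  clear hs
  induction k generalizing b v with
  | zero =>
    rw [pow_zero, Equiv.Perm.one_apply] at hk
    obtain ⟨rfl, rfl⟩ := Fin.cons_inj.1 hk
    exact ⟨Or.inl rfl, Equiv.Perm.SameCycle.refl _ _⟩
  | succ k ih =>
    rw [pow_succ', Equiv.Perm.mul_apply] at hk
    obtain ⟨b', v', e⟩ : ∃ (b' : Fin 3) (v' : Word n),
        (G.perm ^ k) (Fin.cons a w : Word (n + 1)) = (Fin.cons b' v' : Word (n + 1)) :=
      ⟨_, _, (Fin.cons_self_tail _).symm⟩
    obtain ⟨hb, hv⟩ := ih e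
    rw [e, h.perm_cons] at hk
    obtain ⟨rfl, rfl⟩ := Fin.cons_inj.1 hk
    refine ⟨key π a b' hb, ?_⟩
    have ht : t b' = t a := by rcases hb with rfl | rfl | rfl <;> simp only [h.t_perm]
    split_ifs
    · rw [ht]; exact hv.trans (sameCycle_of_apply_eq rfl)
    · exact hv

/-- The lexicographic order compares first letters first, so the largest word of a cycle starts with
the top letter of the orbit, and its tail is the largest in the cycle of the return map. -/
theorem isLastInCycle_cons (h : IsBlock π t G) (a : Fin 3) (w : Word n) :
    IsLastInCycle G.perm (Fin.cons a w : Word (n + 1)) ↔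
      IsTop π a ∧ IsLastInCycle (t a).perm w := by
  constructor
  · intro hl
    have ha : IsTop π a := by
      obtain ⟨m, hm, hma, hs⟩ := h.exists_top a
      have key : ∀ (π : Equiv.Perm (Fin 3)) (a m : Fin 3), IsTop π m →
        (m = a ∨ m = π a ∨ m = π (π a)) → (m < a ∨ m = a) → IsTop π a := by decide
      refine key π a m hm hma ?_
      exact ((toLex_cons_le a m w w).1 (hl _ (hs w))).imp_right And.left
    refine ⟨ha, fun v hv => ?_⟩
    rcases (toLex_cons_le a a v w).1 (hl _ (h.sameCycle_of_top ha hv)) with h' | h'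
    · exact absurd h' (lt_irrefl a)
    · exact h'.2
  · rintro ⟨ha, hw⟩ u hu
    rw [← Fin.cons_self_tail u] at hu ⊢
    obtain ⟨hb, hv⟩ := h.of_sameCycle hu
    have key : ∀ (π : Equiv.Perm (Fin 3)) (a b : Fin 3), IsTop π a →
        (b = a ∨ b = π a ∨ b = π (π a)) → b < a ∨ b = a := by decide
    exact (toLex_cons_le _ _ _ _).2 ((key π a _ ha hb).imp_right fun e => ⟨e, hw _ hv⟩)

theorem insertion_cons (h : IsBlock π t G) (a : Fin 3) (w : Word n) :
    insertion G (Fin.cons a w : Word (n + 1)) = if IsTop π a then insertion (t a) w else 1 := by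
  simp only [insertion, h.label_cons]
  rw [h.isLastInCycle_cons]
  by_cases ha : IsTop π a
  · by_cases hw : IsLastInCycle (t a).perm w
    · rw [if_pos ⟨ha, hw⟩, if_pos ha, if_pos hw]
    · rw [if_neg fun h => hw h.2, if_pos ha, if_neg hw]
  · rw [if_neg fun h => ha h.1, if_neg ha]

/-- Iteration appends a letter at the end and the block structure splits off the first letter. The
two operations are compatible because, by `insertion_cons`, nontrivial insertions occur only over
top first letters and agree with those of the sections. -/
theorem iterate (h : IsBlock π t G) :
    IsBlock π (fun a => CubicMarkov.iterate (t a)) (CubicMarkov.iterate G) where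
  t_perm a := by rw [h.t_perm]
  perm_cons a w := by
    obtain ⟨v, c, rfl⟩ : ∃ (v : Word n) (c : Fin 3), w = (Fin.snoc v c : Word (n + 1)) :=
      ⟨_, _, (Fin.snoc_init_self w).symm⟩
    have e (b : Fin 3) (v : Word n) (c : Fin 3) :
        (Fin.cons b (Fin.snoc v c : Word (n + 1)) : Word (n + 2)) =
          (Fin.snoc (Fin.cons b v : Word (n + 1)) c : Word (n + 2)) :=
      Fin.cons_snoc_eq_snoc_cons b v c
    simp only [CubicMarkov.iterate, extend, Equiv.coe_fn_mk, e, Fin.init_snoc, Fin.snoc_last,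
      h.perm_cons, h.insertion_cons]
    by_cases ha : IsTop π a
    · simp only [ha, if_true, e]
    · simp only [ha, if_false, Equiv.Perm.one_apply, e]
  label_cons a w := by
    obtain ⟨v, c, rfl⟩ : ∃ (v : Word n) (c : Fin 3), w = (Fin.snoc v c : Word (n + 1)) :=
      ⟨_, _, (Fin.snoc_init_self w).symm⟩
    have e (b : Fin 3) (v : Word n) (c : Fin 3) :
        (Fin.cons b (Fin.snoc v c : Word (n + 1)) : Word (n + 2)) =
          (Fin.snoc (Fin.cons b v : Word (n + 1)) c : Word (n + 2)) :=
      Fin.cons_snoc_eq_snoc_cons b v c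
    simp only [CubicMarkov.iterate, e, Fin.init_snoc, Fin.snoc_last, h.label_cons]

end IsBlock

/-- The typed permutations of the words of length zero. -/
def trivialTyped (t : Label) : Typed 0 where
  perm := 1
  label := fun _ => t
  label_perm := fun _ => rfl

/-- The `n`-th iterate of the type `[t, 1]`. -/
def iterTyped (t : Label) : (n : ℕ) → Typed n
  | 0 => trivialTyped t
  | n + 1 => iterate (iterTyped t n)

theorem isBlock_level1 (π : Equiv.Perm (Fin 3)) (l : Fin 3 → Label) (G : Typed 1)
    (hp : G.perm = level1 π) (hl : ∀ w, G.label w = l (w 0)) (hπ : ∀ a, l (π a) = l a) :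
    IsBlock π (fun a => iterTyped (l a) 0) G where
  t_perm a := by rw [hπ]
  perm_cons a w := by
    rw [hp]
    refine funext fun (i : Fin 1) => ?_
    rw [Subsingleton.elim i 0]
    simp [level1, Equiv.permCongr_apply]
  label_cons a w := by rw [hl, Fin.cons_zero]; rfl

theorem typed_ext {n : ℕ} {g h : Typed n} (hp : g.perm = h.perm) (hl : g.label = h.label) :
    g = h := by
  cases g; cases h; simp_all

theorem isLastInCycle_zero (g : Typed 0) (w : Word 0) : IsLastInCycle g.perm w :=
  fun v _ => le_of_eq (congrArg toLex (Subsingleton.elim v w))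

/-- Starting the iteration at level 0 makes `x` and `y` the iterates of `[s, 1]` and `[n, 1]`, so
the sections of the generators are again such iterates. -/
theorem iterate_trivialTyped_perm (t : Label) :
    (iterate (trivialTyped t)).perm =
      level1 (match t with | Label.s => finRotate 3 | Label.n => Equiv.swap 0 1) := by
  ext1 w
  refine funext fun (i : Fin 1) => ?_
  rw [Subsingleton.elim i (Fin.last 0)]
  simp only [iterate, extend, Equiv.coe_fn_mk, Fin.snoc_last, insertion, isLastInCycle_zero, if_true]
  cases t <;> simp [level1, Equiv.permCongr_apply, trivialTyped]

theorem xTyped_eq (n : ℕ) : xTyped n = iterTyped Label.s (n + 1) := by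
  induction n with
  | zero => exact typed_ext (iterate_trivialTyped_perm Label.s).symm rfl
  | succ n ih => rw [xTyped, ih]; rfl

theorem yTyped_eq (n : ℕ) : yTyped n = iterTyped Label.n (n + 1) := by
  induction n with
  | zero => exact typed_ext (iterate_trivialTyped_perm Label.n).symm rfl
  | succ n ih => rw [yTyped, ih]; rfl

theorem x_eq (n : ℕ) : x n = (iterTyped Label.s n).perm := by
  cases n with
  | zero => rfl
  | succ n => rw [x, xTyped_eq]

theorem y_eq (n : ℕ) : y n = (iterTyped Label.n n).perm := by
  cases n with
  | zero => rfl
  | succ n => rw [y, yTyped_eq]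

/-- The type of the point `a` under `y₁` and `z₁`. -/
def rootLabel (a : Fin 3) : Label := if a = 2 then Label.s else Label.n

theorem isBlock_xTyped (n : ℕ) :
    IsBlock (finRotate 3) (fun _ => iterTyped Label.s n) (xTyped n) := by
  induction n with
  | zero => exact isBlock_level1 _ (fun _ => Label.s) _ rfl (fun _ => rfl) (fun _ => rfl)
  | succ n ih => exact ih.iterate

theorem isBlock_yTyped (n : ℕ) :
    IsBlock (Equiv.swap 0 1) (fun a => iterTyped (rootLabel a) n) (yTyped n) := by
  induction n with
  | zero => exact isBlock_level1 _ rootLabel _ rfl (fun _ => rfl) (by decide)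
  | succ n ih => exact ih.iterate

theorem isBlock_zTyped (n : ℕ) :
    IsBlock 1 (fun a => iterTyped (rootLabel a) n) (zTyped n) := by
  induction n with
  | zero =>
    refine isBlock_level1 _ rootLabel _ ?_ (fun _ => rfl) (by decide)
    ext w i
    rw [Subsingleton.elim i 0]
    simp [level1, zTyped, Equiv.permCongr_apply]
  | succ n ih => exact ih.iterate

theorem IsBlock.perm_eq {n : ℕ} {π : Equiv.Perm (Fin 3)} {t : Fin 3 → Typed n}
    {G : Typed (n + 1)} (h : IsBlock π t G) :
    G.perm = wreath (fun a => if IsTop π a then (t a).perm else 1) π := by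
  refine perm_ext_cons fun a w => ?_
  rw [h.perm_cons, wreath_cons]
  split_ifs <;> rfl

theorem x_succ (n : ℕ) : x (n + 1) = wreath ![1, 1, x n] (finRotate 3) := by
  rw [x, (isBlock_xTyped n).perm_eq, x_eq]
  congr 1
  funext a
  fin_cases a
  · exact if_neg (by decide)
  · exact if_neg (by decide)
  · exact if_pos (by decide)

theorem y_succ (n : ℕ) : y (n + 1) = wreath ![1, y n, x n] (Equiv.swap 0 1) := by
  rw [y, (isBlock_yTyped n).perm_eq, x_eq, y_eq]
  congr 1
  funext a
  fin_cases a
  · exact if_neg (by decide)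
  · exact if_pos (by decide)
  · exact if_pos (by decide)

theorem z_succ (n : ℕ) : z (n + 1) = wreath ![y n, y n, x n] 1 := by
  rw [z, (isBlock_zTyped n).perm_eq, x_eq, y_eq]
  congr 1
  funext a
  fin_cases a
  · exact if_pos (by decide)
  · exact if_pos (by decide)
  · exact if_pos (by decide)

theorem embed_eq {n : ℕ} (σ : Equiv.Perm (Word n)) : embed σ = wreath ![σ, 1, 1] 1 := by
  refine perm_ext_cons fun a w => ?_
  rw [wreath_cons]
  fin_cases a <;> simp [embed]

/-! ### The groups in terms of the wreath decomposition -/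

/-- The even (`e = 1`) and odd (`e = -1`) automorphisms: those whose action on the first letter has
sign `e`, with sections whose signs have product `e`. -/
def parityClass : (n : ℕ) → ℤˣ → Set (Equiv.Perm (Word n))
  | 0, _ => {1}
  | n + 1, e => {σ | ∃ (f : Fin 3 → Equiv.Perm (Word n)) (π : Equiv.Perm (Fin 3)) (s : Fin 3 → ℤˣ),
      Equiv.Perm.sign π = e ∧ ∏ a, s a = e ∧ (∀ a, f a ∈ parityClass n (s a)) ∧ σ = wreath f π}

/-- The automorphisms acting by `π` on the first letter, with sections of signs `s`. -/
def blockClass (n : ℕ) (π : Equiv.Perm (Fin 3)) (s : Fin 3 → ℤˣ) :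
    Set (Equiv.Perm (Word (n + 1))) :=
  {σ | ∃ f : Fin 3 → Equiv.Perm (Word n), (∀ a, f a ∈ parityClass n (s a)) ∧ σ = wreath f π}

theorem blockClass_congr {n : ℕ} {π ρ : Equiv.Perm (Fin 3)} {s t : Fin 3 → ℤˣ}
    {σ : Equiv.Perm (Word (n + 1))} (hσ : σ ∈ blockClass n π s) (hπ : π = ρ)
    (hs : ∀ a, s a = t a) : σ ∈ blockClass n ρ t := by
  obtain rfl := hπ
  obtain rfl : s = t := funext hs
  exact hσ

theorem mem_parityClass_succ {n : ℕ} {e : ℤˣ} {σ : Equiv.Perm (Word (n + 1))} :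
    σ ∈ parityClass (n + 1) e ↔
      ∃ π s, Equiv.Perm.sign π = e ∧ ∏ a, s a = e ∧ σ ∈ blockClass n π s :=
  ⟨fun ⟨f, π, s, h1, h2, h3, h4⟩ => ⟨π, s, h1, h2, f, h3, h4⟩,
    fun ⟨π, s, h1, h2, f, h3, h4⟩ => ⟨f, π, s, h1, h2, h3, h4⟩⟩

theorem one_mem_parityClass (n : ℕ) : (1 : Equiv.Perm (Word n)) ∈ parityClass n 1 := by
  induction n with
  | zero => rfl
  | succ n ih => exact ⟨1, 1, 1, Equiv.Perm.sign_one, by simp, fun _ => ih, wreath_one.symm⟩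

theorem mul_mem_parityClass {n : ℕ} {d e : ℤˣ} {σ τ : Equiv.Perm (Word n)}
    (hσ : σ ∈ parityClass n d) (hτ : τ ∈ parityClass n e) : σ * τ ∈ parityClass n (d * e) := by
  induction n generalizing d e with
  | zero =>
    obtain rfl : σ = 1 := hσ
    obtain rfl : τ = 1 := hτ
    rfl
  | succ n ih =>
    obtain ⟨f, π, s, h1, h2, h3, rfl⟩ := hσ
    obtain ⟨g, ρ, t, k1, k2, k3, rfl⟩ := hτ
    refine ⟨_, _, fun a => s (ρ a) * t a, ?_, ?_, fun a => ih (h3 (ρ a)) (k3 a), wreath_mul f g π ρ⟩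
    · rw [Equiv.Perm.sign_mul, h1, k1]
    · rw [Finset.prod_mul_distrib, Equiv.prod_comp ρ s, h2, k2]

theorem inv_mem_parityClass {n : ℕ} {e : ℤˣ} {σ : Equiv.Perm (Word n)}
    (hσ : σ ∈ parityClass n e) : σ⁻¹ ∈ parityClass n e := by
  induction n generalizing e with
  | zero =>
    obtain rfl : σ = 1 := hσ
    exact inv_one
  | succ n ih =>
    obtain ⟨f, π, s, h1, h2, h3, rfl⟩ := hσ
    refine ⟨_, _, fun a => s (π⁻¹ a), ?_, ?_, fun a => ih (h3 (π⁻¹ a)), wreath_inv f π⟩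
    · rw [Equiv.Perm.sign_inv, h1]
    · rw [Equiv.prod_comp π⁻¹ s, h2]

theorem mul_mem_blockClass {n : ℕ} {π ρ : Equiv.Perm (Fin 3)} {s t : Fin 3 → ℤˣ}
    {σ τ : Equiv.Perm (Word (n + 1))} (hσ : σ ∈ blockClass n π s) (hτ : τ ∈ blockClass n ρ t) :
    σ * τ ∈ blockClass n (π * ρ) (fun a => s (ρ a) * t a) := by
  obtain ⟨f, hf, rfl⟩ := hσ
  obtain ⟨g, hg, rfl⟩ := hτ
  exact ⟨_, fun a => mul_mem_parityClass (hf (ρ a)) (hg a), wreath_mul f g π ρ⟩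

theorem inv_mem_blockClass {n : ℕ} {π : Equiv.Perm (Fin 3)} {s : Fin 3 → ℤˣ}
    {σ : Equiv.Perm (Word (n + 1))} (hσ : σ ∈ blockClass n π s) :
    σ⁻¹ ∈ blockClass n π⁻¹ (fun a => s (π⁻¹ a)) := by
  obtain ⟨f, hf, rfl⟩ := hσ
  exact ⟨_, fun a => inv_mem_parityClass (hf (π⁻¹ a)), wreath_inv f π⟩

theorem conj_mem_blockClass {n : ℕ} {π : Equiv.Perm (Fin 3)} {s t : Fin 3 → ℤˣ}
    {σ τ : Equiv.Perm (Word (n + 1))} (hσ : σ ∈ blockClass n π s) (hτ : τ ∈ blockClass n 1 t) :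
    σ * τ * σ⁻¹ ∈ blockClass n 1 (fun a => t (π⁻¹ a)) := by
  refine blockClass_congr (mul_mem_blockClass (mul_mem_blockClass hσ hτ) (inv_mem_blockClass hσ))
    (by rw [mul_one, mul_inv_cancel]) fun a => ?_
  rw [Equiv.Perm.one_apply, mul_comm (s (π⁻¹ a)), mul_assoc, Int.units_mul_self, mul_one]

/-! ### Parities of the generators. -/

theorem x_mem_parityClass (n : ℕ) : x n ∈ parityClass n 1 := by
  induction n with
  | zero => rfl
  | succ n ih =>
    refine ⟨_, _, 1, by simp, by simp, fun a => ?_, x_succ n⟩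
    fin_cases a
    exacts [one_mem_parityClass n, one_mem_parityClass n, ih]

theorem y_mem_parityClass (n : ℕ) : y n ∈ parityClass n (-1) := by
  induction n with
  | zero => rfl
  | succ n ih =>
    refine ⟨_, _, ![1, -1, 1], by decide, by decide, fun a => ?_, y_succ n⟩
    fin_cases a
    exacts [one_mem_parityClass n, ih, x_mem_parityClass n]

theorem x_mem_blockClass (n : ℕ) : x (n + 1) ∈ blockClass n (finRotate 3) 1 := by
  refine ⟨_, fun a => ?_, x_succ n⟩
  fin_cases a
  exacts [one_mem_parityClass n, one_mem_parityClass n, x_mem_parityClass n]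

theorem z_mem_blockClass (n : ℕ) : z (n + 1) ∈ blockClass n 1 ![-1, -1, 1] := by
  refine ⟨_, fun a => ?_, z_succ n⟩
  fin_cases a
  exacts [y_mem_parityClass n, y_mem_parityClass n, x_mem_parityClass n]

theorem embed_mem_blockClass {n : ℕ} {σ : Equiv.Perm (Word n)} (hσ : σ ∈ parityClass n 1) :
    embed σ ∈ blockClass n 1 1 := by
  refine ⟨_, fun a => ?_, embed_eq σ⟩
  fin_cases a
  exacts [hσ, one_mem_parityClass n, one_mem_parityClass n]

theorem blockClass_subset_parityClass {n : ℕ} {π : Equiv.Perm (Fin 3)} {s : Fin 3 → ℤˣ} {e : ℤˣ}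
    (h1 : Equiv.Perm.sign π = e) (h2 : ∏ a, s a = e) :
    blockClass n π s ⊆ parityClass (n + 1) e :=
  fun _ hσ => mem_parityClass_succ.2 ⟨π, s, h1, h2, hσ⟩

/-- The subgroup of even automorphisms. -/
def evenGroup (n : ℕ) : Subgroup (Equiv.Perm (Word n)) where
  carrier := parityClass n 1
  one_mem' := one_mem_parityClass n
  mul_mem' := fun h k => by simpa using mul_mem_parityClass h k
  inv_mem' := inv_mem_parityClass

/-- The group of all automorphisms with a parity. -/
def fullGroup (n : ℕ) : Subgroup (Equiv.Perm (Word n)) where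
  carrier := {σ | ∃ e, σ ∈ parityClass n e}
  one_mem' := ⟨1, one_mem_parityClass n⟩
  mul_mem' := fun ⟨_, h⟩ ⟨_, k⟩ => ⟨_, mul_mem_parityClass h k⟩
  inv_mem' := fun ⟨_, h⟩ => ⟨_, inv_mem_parityClass h⟩

/-- The subgroup of automorphisms acting trivially on the first letter with even sections. -/
def baseGroup (n : ℕ) : Subgroup (Equiv.Perm (Word (n + 1))) where
  carrier := blockClass n 1 1
  one_mem' := ⟨1, fun _ => one_mem_parityClass n, wreath_one.symm⟩
  mul_mem' := fun h k => blockClass_congr (mul_mem_blockClass h k) (one_mul 1) fun _ => one_mul 1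
  inv_mem' := fun h => blockClass_congr (inv_mem_blockClass h) inv_one fun _ => rfl

/-- The subgroup of even automorphisms acting trivially on the first letter. -/
def kernelGroup (n : ℕ) : Subgroup (Equiv.Perm (Word (n + 1))) where
  carrier := {σ | ∃ s, ∏ a, s a = 1 ∧ σ ∈ blockClass n 1 s}
  one_mem' := ⟨1, by simp, 1, fun _ => one_mem_parityClass n, wreath_one.symm⟩
  mul_mem' := fun ⟨s, hs, h⟩ ⟨t, ht, k⟩ => ⟨fun a => s a * t a, by
    rw [Finset.prod_mul_distrib, hs, ht, one_mul], by simpa using mul_mem_blockClass h k⟩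
  inv_mem' := fun ⟨s, hs, h⟩ => ⟨s, hs, by simpa using inv_mem_blockClass h⟩

/-! ### Identification of the groups by parity conditions. -/

theorem L_le_evenGroup (n : ℕ) : L n ≤ evenGroup n := by
  induction n with
  | zero => exact bot_le
  | succ n ih =>
    rw [L, Subgroup.closure_le]
    rintro g ((rfl | rfl) | ⟨σ, hσ, rfl⟩)
    · exact x_mem_parityClass _
    · exact blockClass_subset_parityClass (by simp) (by decide) (z_mem_blockClass n)
    · exact blockClass_subset_parityClass (by simp) (by simp) (embed_mem_blockClass (ih hσ))

theorem x_mem_L (n : ℕ) : x (n + 1) ∈ L (n + 1) :=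
  Subgroup.subset_closure (Or.inl (Or.inl rfl))

theorem z_mem_L (n : ℕ) : z (n + 1) ∈ L (n + 1) :=
  Subgroup.subset_closure (Or.inl (Or.inr rfl))

theorem embed_mem_L {n : ℕ} {σ : Equiv.Perm (Word n)} (hσ : σ ∈ L n) : embed σ ∈ L (n + 1) :=
  Subgroup.subset_closure (Or.inr ⟨σ, hσ, rfl⟩)

theorem le_normalClosureIn {Γ : Type*} [Group Γ] (G : Subgroup Γ) (S : Set Γ) :
    S ⊆ normalClosureIn G S :=
  fun b hb => Subgroup.subset_closure ⟨1, one_mem _, b, hb, by simp⟩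

theorem conj_mem_normalClosureIn {Γ : Type*} [Group Γ] {G : Subgroup Γ} {S : Set Γ} {g a : Γ}
    (hg : g ∈ G) (ha : a ∈ normalClosureIn G S) : g * a * g⁻¹ ∈ normalClosureIn G S := by
  induction ha using Subgroup.closure_induction with
  | mem a ha =>
    obtain ⟨h, hh, b, hb, rfl⟩ := ha
    exact Subgroup.subset_closure ⟨g * h, mul_mem hg hh, b, hb, by group⟩
  | one => simp
  | mul a b _ _ ha hb =>
    have := mul_mem ha hb
    rwa [show g * a * g⁻¹ * (g * b * g⁻¹) = g * (a * b) * g⁻¹ by group] at this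
  | inv a _ ha =>
    have := inv_mem ha
    rwa [show (g * a * g⁻¹)⁻¹ = g * a⁻¹ * g⁻¹ by group] at this

theorem normalClosureIn_le {Γ : Type*} [Group Γ] {G N : Subgroup Γ} {S : Set Γ} (hS : S ⊆ N)
    (hN : ∀ g ∈ G, ∀ a ∈ N, g * a * g⁻¹ ∈ N) : normalClosureIn G S ≤ N := by
  rw [normalClosureIn, Subgroup.closure_le]
  rintro a ⟨g, hg, b, hb, rfl⟩
  exact hN g hg b (hS hb)

theorem normalClosureIn_le_self {Γ : Type*} [Group Γ] {G : Subgroup Γ} {S : Set Γ} (hS : S ⊆ G) :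
    normalClosureIn G S ≤ G :=
  normalClosureIn_le hS fun _ hg _ ha => mul_mem (mul_mem hg ha) (inv_mem hg)

theorem H_le_L (n : ℕ) : H (n + 1) ≤ L (n + 1) :=
  normalClosureIn_le_self (by rintro _ ⟨σ, hσ, rfl⟩; exact embed_mem_L hσ)

theorem H_le_baseGroup (n : ℕ) : H (n + 1) ≤ baseGroup n := by
  refine normalClosureIn_le ?_ fun g hg a ha => ?_
  · rintro _ ⟨σ, hσ, rfl⟩
    exact embed_mem_blockClass (L_le_evenGroup n hσ)
  · obtain ⟨π, s, -, -, hg⟩ := mem_parityClass_succ.1 (L_le_evenGroup (n + 1) hg)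
    exact conj_mem_blockClass hg ha

/-- The sections in `H (n + 1)` can be prescribed one at a time. -/
theorem wreath_mulSingle_mem_H {n : ℕ} (a : Fin 3) {σ : Equiv.Perm (Word n)} (hσ : σ ∈ L n) :
    wreath (Pi.mulSingle a σ) 1 ∈ H (n + 1) := by
  have hx : x n ∈ L n := by
    cases n with
    | zero => exact one_mem _
    | succ n => exact x_mem_L n
  have h0 {σ : Equiv.Perm (Word n)} (hσ : σ ∈ L n) : wreath (Pi.mulSingle 0 σ) 1 ∈ H (n + 1) := by
    have : wreath (Pi.mulSingle 0 σ) 1 = embed σ := by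
      rw [embed_eq]
      congr 1
      funext b
      fin_cases b <;> simp
    rw [this]
    exact le_normalClosureIn _ _ ⟨σ, hσ, rfl⟩
  -- Conjugation by `x` carries the section from 0 to 1, and then from 1 to 2, without altering it,
  -- since the sections of `x` at 0 and 1 are trivial.
  have h1 {σ : Equiv.Perm (Word n)} (hσ : σ ∈ L n) : wreath (Pi.mulSingle 1 σ) 1 ∈ H (n + 1) := by
    have : wreath (Pi.mulSingle 1 σ) 1 =
        x (n + 1) * wreath (Pi.mulSingle 0 σ) 1 * (x (n + 1))⁻¹ := by
      rw [eq_mul_inv_iff_mul_eq, x_succ, wreath_mul, wreath_mul]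
      congr 1
      · funext b
        fin_cases b <;> simp
    rw [this]
    exact conj_mem_normalClosureIn (x_mem_L n) (h0 hσ)
  have h2 {σ : Equiv.Perm (Word n)} (hσ : σ ∈ L n) : wreath (Pi.mulSingle 2 σ) 1 ∈ H (n + 1) := by
    have : wreath (Pi.mulSingle 2 σ) 1 =
        x (n + 1) * wreath (Pi.mulSingle 1 σ) 1 * (x (n + 1))⁻¹ := by
      rw [eq_mul_inv_iff_mul_eq, x_succ, wreath_mul, wreath_mul]
      congr 1
      · funext b
        fin_cases b <;> simp
    rw [this]
    exact conj_mem_normalClosureIn (x_mem_L n) (h1 hσ)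
  fin_cases a
  exacts [h0 hσ, h1 hσ, h2 hσ]

theorem baseGroup_le_H {n : ℕ} (hL : evenGroup n ≤ L n) : baseGroup n ≤ H (n + 1) := by
  rintro _ ⟨f, hf, rfl⟩
  have e : wreath f 1 = wreath (Pi.mulSingle 0 (f 0)) 1 * wreath (Pi.mulSingle 1 (f 1)) 1 *
      wreath (Pi.mulSingle 2 (f 2)) 1 := by
    rw [wreath_mul, wreath_mul]
    congr 1
    funext b
    fin_cases b <;> simp
  rw [e]
  exact mul_mem (mul_mem (wreath_mulSingle_mem_H 0 (hL (hf 0)))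
    (wreath_mulSingle_mem_H 1 (hL (hf 1)))) (wreath_mulSingle_mem_H 2 (hL (hf 2)))

/-- A subgroup containing `H`, `z` and its conjugates contains the kernel of the action of the even
automorphisms on the first letter. -/
theorem kernelGroup_le {n : ℕ} {N : Subgroup (Equiv.Perm (Word (n + 1)))} (hH : baseGroup n ≤ N)
    (hz : z (n + 1) ∈ N) (hN : ∀ a ∈ N, x (n + 1) * a * (x (n + 1))⁻¹ ∈ N) :
    kernelGroup n ≤ N := by
  -- Two elements of the same block over `π = 1` differ by an element of `baseGroup`, so one
  -- representative in `N` suffices.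
  have key {s : Fin 3 → ℤˣ} {τ : Equiv.Perm (Word (n + 1))} (hτ : τ ∈ N)
      (hτs : τ ∈ blockClass n 1 s) {σ : Equiv.Perm (Word (n + 1))} (hσ : σ ∈ blockClass n 1 s) :
      σ ∈ N := by
    have h : σ * τ⁻¹ ∈ N := hH (show _ ∈ blockClass n 1 1 by
      refine blockClass_congr (mul_mem_blockClass hσ (inv_mem_blockClass hτs)) (by simp) fun a => ?_
      simp [Int.units_mul_self])
    simpa using mul_mem h hτ
  have hz1 := hN _ hz
  have hz2 := hN _ hz1
  have kz := z_mem_blockClass n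
  have kz1 := conj_mem_blockClass (x_mem_blockClass n) kz
  have kz2 := conj_mem_blockClass (x_mem_blockClass n) kz1
  -- The nontrivial sign vectors of product 1 are those of `z` and its two conjugates by powers of
  -- `x`.
  have hcases : ∀ s : Fin 3 → ℤˣ, ∏ a, s a = 1 → s = 1 ∨ s = ![-1, -1, 1] ∨
      s = (fun a => ![-1, -1, 1] ((finRotate 3)⁻¹ a)) ∨
      s = (fun a => ![-1, -1, 1] ((finRotate 3)⁻¹ ((finRotate 3)⁻¹ a))) := by decide
  rintro σ ⟨s, hs, hσ⟩
  rcases hcases s hs with rfl | rfl | rfl | rfl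
  · exact hH hσ
  · exact key hz kz hσ
  · exact key hz1 kz1 hσ
  · exact key hz2 kz2 hσ

/-- An even permutation of three letters is a power of the rotation, so at most two multiplications
by `x` bring an even automorphism into the kernel, which `z` and `H` generate up to conjugation. -/
theorem evenGroup_le_L (n : ℕ) : evenGroup n ≤ L n := by
  induction n with
  | zero =>
    rintro σ (rfl : σ = 1)
    exact one_mem _
  | succ n ih =>
    have hK : kernelGroup n ≤ L (n + 1) :=
      kernelGroup_le ((baseGroup_le_H ih).trans (H_le_L n)) (z_mem_L n) fun a ha =>
        mul_mem (mul_mem (x_mem_L n) ha) (inv_mem (x_mem_L n))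
    intro σ hσ
    obtain ⟨π, s, h1, h2, hσ⟩ := mem_parityClass_succ.1 hσ
    have step {π : Equiv.Perm (Fin 3)} {σ : Equiv.Perm (Word (n + 1))} {s : Fin 3 → ℤˣ}
        (hσ : σ ∈ blockClass n π s) :
        σ * x (n + 1) ∈ blockClass n (π * finRotate 3) fun a => s (finRotate 3 a) := by
      simpa using mul_mem_blockClass hσ (x_mem_blockClass n)
    have hx := x_mem_L n
    have hcases : ∀ π : Equiv.Perm (Fin 3), Equiv.Perm.sign π = 1 →
        π = 1 ∨ π * finRotate 3 = 1 ∨ π * finRotate 3 * finRotate 3 = 1 := by decide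
    rcases hcases π h1 with h | h | h
    · subst h
      exact hK ⟨s, h2, hσ⟩
    · have hσ1 := step hσ
      rw [h] at hσ1
      exact (Subgroup.mul_mem_cancel_right _ hx).1
        (hK ⟨_, by rw [Equiv.prod_comp (finRotate 3) s, h2], hσ1⟩)
    · have hσ2 := step (step hσ)
      rw [h] at hσ2
      refine (Subgroup.mul_mem_cancel_right _ hx).1 ((Subgroup.mul_mem_cancel_right _ hx).1
        (hK ⟨_, ?_, hσ2⟩))
      rw [Equiv.prod_comp (finRotate 3) fun a => s (finRotate 3 a), Equiv.prod_comp (finRotate 3) s,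
        h2]

theorem L_eq (n : ℕ) : L n = evenGroup n := le_antisymm (L_le_evenGroup n) (evenGroup_le_L n)

theorem H_eq (n : ℕ) : H (n + 1) = baseGroup n :=
  le_antisymm (H_le_baseGroup n) (baseGroup_le_H (evenGroup_le_L n))

theorem K_eq (n : ℕ) : K (n + 1) = kernelGroup n := by
  have hsub : Subgroup.closure ((H (n + 1) : Set (Equiv.Perm (Word (n + 1)))) ∪ {z (n + 1)}) ≤
      kernelGroup n := by
    rw [Subgroup.closure_le, Set.union_subset_iff, Set.singleton_subset_iff, H_eq]
    exact ⟨fun σ hσ => ⟨1, by simp, hσ⟩, ⟨_, by decide, z_mem_blockClass n⟩⟩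
  refine le_antisymm (normalClosureIn_le hsub ?_) (kernelGroup_le ?_ ?_ ?_)
  · rintro g hg a ⟨s, hs, ha⟩
    obtain ⟨π, t, -, -, hg⟩ := mem_parityClass_succ.1 (L_le_evenGroup (n + 1) hg)
    exact ⟨_, by rw [Equiv.prod_comp π⁻¹ s, hs], conj_mem_blockClass hg ha⟩
  · rw [← H_eq]
    exact fun σ hσ => le_normalClosureIn _ _ (Subgroup.subset_closure (Or.inl hσ))
  · exact le_normalClosureIn _ _ (Subgroup.subset_closure (Or.inr rfl))
  · exact fun a ha => conj_mem_normalClosureIn (x_mem_L n) ha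

theorem L_le_M (n : ℕ) : L (n + 1) ≤ M (n + 1) :=
  Subgroup.closure_mono (Set.union_subset_union_left _ (by
    rintro _ (rfl | rfl)
    · exact Or.inl rfl
    · exact Or.inr (Or.inr rfl)))

theorem M_eq (n : ℕ) : M (n + 1) = fullGroup (n + 1) := by
  refine le_antisymm ?_ ?_
  · rw [M, Subgroup.closure_le]
    rintro g ((rfl | rfl | rfl) | ⟨σ, hσ, rfl⟩)
    · exact ⟨_, x_mem_parityClass _⟩
    · exact ⟨_, y_mem_parityClass _⟩
    · exact ⟨_, L_le_evenGroup _ (z_mem_L n)⟩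
    · exact ⟨_, L_le_evenGroup _ (embed_mem_L hσ)⟩
  · rintro σ ⟨e, hσ⟩
    have hy : y (n + 1) ∈ M (n + 1) := Subgroup.subset_closure (Or.inl (Or.inr (Or.inl rfl)))
    rcases Int.units_eq_one_or e with rfl | rfl
    · exact L_le_M n (evenGroup_le_L _ hσ)
    · refine (Subgroup.mul_mem_cancel_right _ hy).1 (L_le_M n (evenGroup_le_L _ ?_))
      exact mul_mem_parityClass hσ (y_mem_parityClass _)

/-! ### The cosets -/

/-- With the right action, `cosetL g G` consists of the products `k * g` in composition order.
Factors from `baseGroup` do not change section parities, and any two elements of the block differ by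
such a factor. -/
theorem cosetL_baseGroup {n : ℕ} {s : Fin 3 → ℤˣ} {g : Equiv.Perm (Word (n + 1))}
    (hg : g ∈ blockClass n 1 s) : cosetL g (baseGroup n) = blockClass n 1 s := by
  ext σ
  constructor
  · rintro ⟨k, hk, rfl⟩
    exact blockClass_congr (mul_mem_blockClass (hk : k ∈ blockClass n 1 1) hg) (one_mul 1)
      fun _ => one_mul _
  · intro hσ
    refine ⟨σ * g⁻¹, show _ ∈ blockClass n 1 1 from ?_, ?_⟩
    · refine blockClass_congr (mul_mem_blockClass hσ (inv_mem_blockClass hg)) (by simp) fun a => ?_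
      simp [Int.units_mul_self]
    · rw [← Equiv.Perm.mul_def, inv_mul_cancel_right]

theorem cosetR_kernelGroup {n : ℕ} {π : Equiv.Perm (Fin 3)} {g : Equiv.Perm (Word (n + 1))}
    (hg : g ∈ blockClass n π 1) :
    cosetR (kernelGroup n) g = {σ | ∃ s, ∏ a, s a = 1 ∧ σ ∈ blockClass n π s} := by
  ext σ
  constructor
  · rintro ⟨k, ⟨s, hs, hk⟩, rfl⟩
    exact ⟨s, hs, blockClass_congr (mul_mem_blockClass hg hk) (mul_one π) fun _ => one_mul _⟩
  · rintro ⟨s, hs, hσ⟩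
    refine ⟨g⁻¹ * σ, ⟨s, hs, ?_⟩, ?_⟩
    · simpa using mul_mem_blockClass (inv_mem_blockClass hg) hσ
    · rw [← Equiv.Perm.mul_def, mul_inv_cancel_left]

theorem cosetR_evenGroup {n : ℕ} {e : ℤˣ} {g : Equiv.Perm (Word n)} (hg : g ∈ parityClass n e) :
    cosetR (evenGroup n) g = parityClass n e := by
  ext σ
  constructor
  · rintro ⟨k, hk, rfl⟩
    have h := mul_mem_parityClass hg (hk : k ∈ parityClass n 1)
    rwa [mul_one] at h
  · intro hσ
    refine ⟨g⁻¹ * σ, show _ ∈ parityClass n 1 from ?_, ?_⟩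
    · simpa [Int.units_mul_self] using mul_mem_parityClass (inv_mem_parityClass hg) hσ
    · rw [← Equiv.Perm.mul_def, mul_inv_cancel_left]

theorem conj_mem_blockClass_right {n : ℕ} {π : Equiv.Perm (Fin 3)} {s t : Fin 3 → ℤˣ}
    {σ τ : Equiv.Perm (Word (n + 1))} (hσ : σ ∈ blockClass n π s) (hτ : τ ∈ blockClass n 1 t) :
    conj τ σ ∈ blockClass n 1 (fun a => t (π a)) := by
  have h := conj_mem_blockClass (inv_mem_blockClass hσ) hτ
  rwa [inv_inv, inv_inv] at h

/-! ### Disjointness -/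

theorem parityClass_eq_of_mem {n : ℕ} {d e : ℤˣ} {σ : Equiv.Perm (Word (n + 1))}
    (hd : σ ∈ parityClass (n + 1) d) (he : σ ∈ parityClass (n + 1) e) : d = e := by
  obtain ⟨f, π, s, h1, -, -, rfl⟩ := hd
  obtain ⟨g, ρ, t, k1, -, -, h⟩ := he
  rw [← h1, ← k1, (wreath_injective h).2]

/-- The sections must live on level at least one, since on level 0 the identity has both parities.
This is where `n ≥ 2` matters. -/
theorem blockClass_eq_of_mem {n : ℕ} {π ρ : Equiv.Perm (Fin 3)} {s t : Fin 3 → ℤˣ}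
    {σ : Equiv.Perm (Word (n + 2))} (hs : σ ∈ blockClass (n + 1) π s)
    (ht : σ ∈ blockClass (n + 1) ρ t) : π = ρ ∧ s = t := by
  obtain ⟨f, hf, rfl⟩ := hs
  obtain ⟨g, hg, h⟩ := ht
  obtain ⟨rfl, rfl⟩ := wreath_injective h
  exact ⟨rfl, funext fun a => parityClass_eq_of_mem (hf a) (hg a)⟩

/-! ### Generating functions of the classes -/

/-- `parityClass` as a finite set. -/
def parityFinset (n : ℕ) (e : ℤˣ) : Finset (Equiv.Perm (Word n)) :=
  (parityClass n e).toFinite.toFinset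

/-- `blockClass` as a finite set. -/
def blockFinset (n : ℕ) (π : Equiv.Perm (Fin 3)) (s : Fin 3 → ℤˣ) :
    Finset (Equiv.Perm (Word (n + 1))) :=
  (blockClass n π s).toFinite.toFinset

@[simp] theorem mem_parityFinset {n : ℕ} {e : ℤˣ} {σ : Equiv.Perm (Word n)} :
    σ ∈ parityFinset n e ↔ σ ∈ parityClass n e :=
  Set.Finite.mem_toFinset _

@[simp] theorem mem_blockFinset {n : ℕ} {π : Equiv.Perm (Fin 3)} {s : Fin 3 → ℤˣ}
    {σ : Equiv.Perm (Word (n + 1))} : σ ∈ blockFinset n π s ↔ σ ∈ blockClass n π s :=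
  Set.Finite.mem_toFinset _

theorem sum_parityFinset_mul_left {A : Type*} [AddCommMonoid A] {n : ℕ} {d : ℤˣ}
    {g : Equiv.Perm (Word n)} (hg : g ∈ parityClass n d) (e : ℤˣ) (F : Equiv.Perm (Word n) → A) :
    ∑ σ ∈ parityFinset n e, F (g * σ) = ∑ σ ∈ parityFinset n (d * e), F σ := by
  refine Finset.sum_nbij' (g * ·) (g⁻¹ * ·) ?_ ?_ ?_ ?_ ?_
  · exact fun σ hσ => mem_parityFinset.2 (mul_mem_parityClass hg (mem_parityFinset.1 hσ))
  · intro σ hσ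
    have h := mul_mem_parityClass (inv_mem_parityClass hg) (mem_parityFinset.1 hσ)
    rw [← mul_assoc, Int.units_mul_self, one_mul] at h
    exact mem_parityFinset.2 h
  · exact fun σ _ => inv_mul_cancel_left g σ
  · exact fun σ _ => mul_inv_cancel_left g σ
  · exact fun σ _ => rfl

theorem sum_parityFinset_mul_right {A : Type*} [AddCommMonoid A] {n : ℕ} {d : ℤˣ}
    {g : Equiv.Perm (Word n)} (hg : g ∈ parityClass n d) (e : ℤˣ) (F : Equiv.Perm (Word n) → A) :
    ∑ σ ∈ parityFinset n e, F (σ * g) = ∑ σ ∈ parityFinset n (e * d), F σ := by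
  refine Finset.sum_nbij' (· * g) (· * g⁻¹) ?_ ?_ ?_ ?_ ?_
  · exact fun σ hσ => mem_parityFinset.2 (mul_mem_parityClass (mem_parityFinset.1 hσ) hg)
  · intro σ hσ
    have h := mul_mem_parityClass (mem_parityFinset.1 hσ) (inv_mem_parityClass hg)
    rw [mul_assoc, Int.units_mul_self, mul_one] at h
    exact mem_parityFinset.2 h
  · exact fun σ _ => mul_inv_cancel_right σ g
  · exact fun σ _ => inv_mul_cancel_right σ g
  · exact fun σ _ => rfl

/-- Multiplication by the odd element `y` exchanges the two classes. -/
theorem card_parityFinset (n : ℕ) (e : ℤˣ) :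
    (parityFinset n e).card = (parityFinset n 1).card := by
  rcases Int.units_eq_one_or e with rfl | rfl
  · rfl
  · have h := sum_parityFinset_mul_left (y_mem_parityClass n) 1 (fun _ => 1)
    rw [mul_one, ← Finset.card_eq_sum_ones, ← Finset.card_eq_sum_ones] at h
    exact h.symm

theorem sum_blockFinset {A : Type*} [AddCommMonoid A] (n : ℕ) (π : Equiv.Perm (Fin 3))
    (s : Fin 3 → ℤˣ) (F : Equiv.Perm (Word (n + 1)) → A) :
    ∑ σ ∈ blockFinset n π s, F σ =
      ∑ a ∈ parityFinset n (s 0), ∑ b ∈ parityFinset n (s 1), ∑ c ∈ parityFinset n (s 2),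
        F (wreath ![a, b, c] π) := by
  simp only [← Finset.sum_product']
  symm
  refine Finset.sum_nbij (fun p => wreath ![p.1, p.2.1, p.2.2] π) ?_ ?_ ?_ ?_
  · rintro ⟨a, b, c⟩ h
    simp only [Finset.mem_product, mem_parityFinset] at h
    refine mem_blockFinset.2 ⟨_, fun i => ?_, rfl⟩
    fin_cases i
    exacts [h.1, h.2.1, h.2.2]
  · rintro ⟨a, b, c⟩ - ⟨a', b', c'⟩ - h
    have h := (wreath_injective h).1
    have h0 := congrFun h 0
    have h1 := congrFun h 1
    have h2 := congrFun h 2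
    simp only [Matrix.cons_val] at h0 h1 h2
    rw [h0, h1, h2]
  · intro σ hσ
    obtain ⟨f, hf, rfl⟩ := mem_blockFinset.1 hσ
    refine ⟨(f 0, f 1, f 2), ?_, ?_⟩
    · simp [hf]
    · refine congrArg (wreath · π) (funext fun i => ?_)
      fin_cases i <;> rfl
  · exact fun _ _ => rfl

theorem genFun_blockFinset_one (n : ℕ) (s : Fin 3 → ℤˣ) :
    genFun (blockFinset n 1 s) = genFun (parityFinset n (s 0)) * genFun (parityFinset n (s 1)) *
      genFun (parityFinset n (s 2)) := by
  rw [genFun, sum_blockFinset, genFun, genFun, genFun, Finset.sum_mul_sum, Finset.sum_mul]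
  refine Finset.sum_congr rfl fun a _ => ?_
  rw [Finset.sum_mul_sum]
  refine Finset.sum_congr rfl fun b _ => Finset.sum_congr rfl fun c _ => ?_
  rw [cycleLengths_wreath_one, AddMonoidAlgebra.single_mul_single,
    AddMonoidAlgebra.single_mul_single, mul_one, mul_one]
  rfl

/-- With two sections fixed, the return product runs once through the class of parity `∏ a, s a` as
the third section varies. The two free sections account for the squared cardinality. -/
theorem genFun_blockFinset_three (n : ℕ) {π : Equiv.Perm (Fin 3)} (h1 : Equiv.Perm.sign π = 1)
    (h2 : π ≠ 1) (s : Fin 3 → ℤˣ) :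
    genFun (blockFinset n π s) =
      ((parityFinset n 1).card : ℚ) ^ 2 • scale 3 (genFun (parityFinset n (∏ a, s a))) := by
  have key : ∀ π : Equiv.Perm (Fin 3), Equiv.Perm.sign π = 1 → π ≠ 1 →
      π 0 = 1 ∧ π 1 = 2 ∨ π 0 = 2 ∧ π 2 = 1 := by decide
  have hc {a b : Equiv.Perm (Word n)} (ha : a ∈ parityFinset n (s 0))
      (hb : b ∈ parityFinset n (s 1)) :
      ∑ c ∈ parityFinset n (s 2), (single (cycleLengths (wreath ![a, b, c] π)) 1 : LengthData) =
        scale 3 (genFun (parityFinset n (∏ a, s a))) := by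
    rw [mem_parityFinset] at ha hb
    simp only [cycleLengths_wreath_three _ h1 h2]
    rw [genFun, map_sum]
    simp only [scale_single]
    rw [Fin.prod_univ_three]
    -- The return product is `c * b * a` for one 3-cycle and `b * c * a` for the other, so the free
    -- section `c` stands at the left end or in the middle.
    rcases key π h1 h2 with ⟨e0, e1⟩ | ⟨e0, e1⟩
    · rw [e0, e1, mul_comm, mul_comm (s 0),
        ← sum_parityFinset_mul_right (mul_mem_parityClass hb ha)]
      simp [mul_assoc]
    · rw [e0, e1, mul_assoc, mul_comm, ← sum_parityFinset_mul_right ha,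
        ← sum_parityFinset_mul_left hb]
      simp
  rw [genFun, sum_blockFinset, Finset.sum_congr rfl fun a ha => Finset.sum_congr rfl fun b hb =>
    hc ha hb, Finset.sum_const, Finset.sum_const, card_parityFinset, card_parityFinset n (s 1),
    ← Nat.cast_smul_eq_nsmul ℚ, ← Nat.cast_smul_eq_nsmul ℚ, smul_smul, pow_two]

theorem genFun_blockFinset_swap (n : ℕ) (s : Fin 3 → ℤˣ) :
    genFun (blockFinset n (Equiv.swap 0 1) s) =
      ((parityFinset n 1).card : ℚ) •
        (scale 2 (genFun (parityFinset n (s 0 * s 1))) * genFun (parityFinset n (s 2))) := by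
  have hb {a : Equiv.Perm (Word n)} (ha : a ∈ parityFinset n (s 0)) :
      ∑ b ∈ parityFinset n (s 1), ∑ c ∈ parityFinset n (s 2),
        (single (cycleLengths (wreath ![a, b, c] (Equiv.swap 0 1))) 1 : LengthData) =
      scale 2 (genFun (parityFinset n (s 0 * s 1))) * genFun (parityFinset n (s 2)) := by
    rw [mem_parityFinset] at ha
    rw [genFun, map_sum, mul_comm (s 0), ← sum_parityFinset_mul_right ha, genFun,
      Finset.sum_mul_sum]
    refine Finset.sum_congr rfl fun b _ => Finset.sum_congr rfl fun c _ => ?_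
    rw [cycleLengths_wreath_swap, scale_single, AddMonoidAlgebra.single_mul_single, mul_one]
    rfl
  rw [genFun, sum_blockFinset, Finset.sum_congr rfl fun a ha => hb ha, Finset.sum_const,
    card_parityFinset, ← Nat.cast_smul_eq_nsmul ℚ]

/-- Conjugation by `wreath 1 ρ`, which permutes first letters only, carries one block onto the other
and preserves cycle types. It reduces all transpositions to `swap 0 1`. -/
theorem genFun_blockFinset_conj (n : ℕ) (π ρ : Equiv.Perm (Fin 3)) (s : Fin 3 → ℤˣ) :
    genFun (blockFinset n (ρ * π * ρ⁻¹) fun a => s (ρ⁻¹ a)) = genFun (blockFinset n π s) := by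
  have hW : wreath (1 : Fin 3 → Equiv.Perm (Word n)) ρ ∈ blockClass n ρ 1 :=
    ⟨1, fun _ => one_mem_parityClass n, rfl⟩
  set W := wreath (1 : Fin 3 → Equiv.Perm (Word n)) ρ
  symm
  refine Finset.sum_nbij' (fun σ => W * σ * W⁻¹) (fun σ => W⁻¹ * σ * W) ?_ ?_ ?_ ?_ ?_
  · intro σ hσ
    rw [mem_blockFinset] at hσ ⊢
    exact blockClass_congr (mul_mem_blockClass (mul_mem_blockClass hW hσ) (inv_mem_blockClass hW))
      rfl fun a => by simp
  · intro σ hσ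
    rw [mem_blockFinset] at hσ ⊢
    exact blockClass_congr (mul_mem_blockClass (mul_mem_blockClass (inv_mem_blockClass hW) hσ) hW)
      (by group) fun a => by simp
  · intro σ _; group
  · intro σ _; group
  · intro σ _
    rw [cycleLengths_conj]

/-- The sign vectors with product `e`. -/
def signVectors (e : ℤˣ) : Finset (Fin 3 → ℤˣ) := {s | ∏ a, s a = e}

theorem sum_genFun_blockFinset_conj (n : ℕ) (π ρ : Equiv.Perm (Fin 3)) (e : ℤˣ) :
    ∑ s ∈ signVectors e, genFun (blockFinset n (ρ * π * ρ⁻¹) s) =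
      ∑ s ∈ signVectors e, genFun (blockFinset n π s) := by
  symm
  refine Finset.sum_nbij' (fun s a => s (ρ⁻¹ a)) (fun s a => s (ρ a)) ?_ ?_ ?_ ?_ ?_
  · intro s hs
    rw [signVectors, Finset.mem_filter_univ] at hs ⊢
    rw [Equiv.prod_comp ρ⁻¹ s, hs]
  · intro s hs
    rw [signVectors, Finset.mem_filter_univ] at hs ⊢
    rw [Equiv.prod_comp ρ s, hs]
  · intro s _; simp
  · intro s _; simp
  · exact fun s _ => (genFun_blockFinset_conj n π ρ s).symm

/-! ### Matching the block recursion with the Markov recursion. -/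

/-- The type whose law is the distribution of cycle types in `parityClass n e`. -/
def parityLabel (e : ℤˣ) : Label := if e = 1 then Label.s else Label.n

theorem signVectors_one :
    signVectors 1 = {1, ![-1, -1, 1], ![-1, 1, -1], ![1, -1, -1]} := by decide

theorem signVectors_neg_one :
    signVectors (-1) = {![-1, 1, 1], ![1, -1, 1], ![1, 1, -1], ![-1, -1, -1]} := by decide

theorem sum_genFun_three {n : ℕ} {N : ℚ} (hN : ((parityFinset n 1).card : ℚ) = N)
    (h : genFun (parityFinset n 1) = N • law Label.s n) {π : Equiv.Perm (Fin 3)}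
    (h1 : Equiv.Perm.sign π = 1) (h2 : π ≠ 1) :
    ∑ s ∈ signVectors 1, genFun (blockFinset n π s) = (4 * N ^ 3) • scale 3 (law Label.s n) := by
  have hs (s) (hs : s ∈ signVectors 1) : genFun (blockFinset n π s) =
      N ^ 3 • scale 3 (law Label.s n) := by
    rw [genFun_blockFinset_three n h1 h2, (Finset.mem_filter_univ _).1 hs, h, hN, map_smul, smul_smul,
      ← pow_succ]
  rw [Finset.sum_congr rfl hs, Finset.sum_const, show (signVectors 1).card = 4 by decide,
    ← Nat.cast_smul_eq_nsmul ℚ, smul_smul]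
  norm_num

/-- Each of the twelve blocks has mass `N ^ 3`: one gives the cube, three give the term with two odd
sections, and eight give the tripled term, as in `law_s_succ`. -/
theorem sum_genFun_even {n : ℕ} {N : ℚ} (hN : ((parityFinset n 1).card : ℚ) = N)
    (h : ∀ e, genFun (parityFinset n e) = N • law (parityLabel e) n) :
    ∑ π with Equiv.Perm.sign π = 1, ∑ s ∈ signVectors 1, genFun (blockFinset n π s) =
      (12 * N ^ 3) • law Label.s (n + 1) := by
  have hs : genFun (parityFinset n 1) = N • law Label.s n := h 1
  have hn : genFun (parityFinset n (-1)) = N • law Label.n n := h (-1)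
  have e1 : (Finset.univ.filter fun π : Equiv.Perm (Fin 3) => Equiv.Perm.sign π = 1) =
      {1, finRotate 3, finRotate 3 ^ 2} := by decide
  rw [e1, Finset.sum_insert (by decide), Finset.sum_insert (by decide), Finset.sum_singleton,
    sum_genFun_three hN hs (π := finRotate 3) (by decide) (by decide),
    sum_genFun_three hN hs (π := finRotate 3 ^ 2) (by decide) (by decide),
    signVectors_one, Finset.sum_insert (by decide), Finset.sum_insert (by decide),
    Finset.sum_insert (by decide), Finset.sum_singleton]
  simp only [genFun_blockFinset_one, Pi.one_apply, Matrix.cons_val, hs, hn]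
  rw [law_s_succ]
  algebra

theorem sum_genFun_odd {n : ℕ} {N : ℚ} (hN : ((parityFinset n 1).card : ℚ) = N)
    (h : ∀ e, genFun (parityFinset n e) = N • law (parityLabel e) n) :
    ∑ π with Equiv.Perm.sign π = -1, ∑ s ∈ signVectors (-1), genFun (blockFinset n π s) =
      (12 * N ^ 3) • law Label.n (n + 1) := by
  have hs : genFun (parityFinset n 1) = N • law Label.s n := h 1
  have hn : genFun (parityFinset n (-1)) = N • law Label.n n := h (-1)
  have e1 : (Finset.univ.filter fun π : Equiv.Perm (Fin 3) => Equiv.Perm.sign π = -1) =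
      {Equiv.swap 0 1, finRotate 3 * Equiv.swap 0 1 * (finRotate 3)⁻¹,
        finRotate 3 ^ 2 * Equiv.swap 0 1 * (finRotate 3 ^ 2)⁻¹} := by decide
  rw [e1, Finset.sum_insert (by decide), Finset.sum_insert (by decide), Finset.sum_singleton,
    sum_genFun_blockFinset_conj, sum_genFun_blockFinset_conj,
    signVectors_neg_one, Finset.sum_insert (by decide), Finset.sum_insert (by decide),
    Finset.sum_insert (by decide), Finset.sum_singleton]
  simp only [genFun_blockFinset_swap, Matrix.cons_val, hN, mul_one, one_mul, neg_mul_neg, hs, hn, map_smul]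
  rw [law_n_succ]
  algebra

theorem genFun_biUnion {n : ℕ} (I : Finset (Equiv.Perm (Fin 3) × (Fin 3 → ℤˣ))) :
    genFun (I.biUnion fun p => blockFinset (n + 1) p.1 p.2) =
      ∑ p ∈ I, genFun (blockFinset (n + 1) p.1 p.2) := by
  refine Finset.sum_biUnion fun p _ q _ hpq => Finset.disjoint_left.2 fun σ hp hq => hpq ?_
  have h := blockClass_eq_of_mem (mem_blockFinset.1 hp) (mem_blockFinset.1 hq)
  exact Prod.ext h.1 h.2

theorem sum_genFun_blockFinset (n : ℕ) (e : ℤˣ) :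
    ∑ π with Equiv.Perm.sign π = e, ∑ s ∈ signVectors e, genFun (blockFinset (n + 1) π s) =
      genFun (parityFinset (n + 2) e) := by
  rw [← Finset.sum_product', ← genFun_biUnion]
  congr 1
  ext σ
  simp [mem_parityClass_succ, signVectors]

/-- On level 0 the two parities coincide, so for each `π` the four sign vectors give the same
one-element block, which is counted four times. -/
theorem sum_genFun_blockFinset_zero (e : ℤˣ) :
    ∑ π with Equiv.Perm.sign π = e, ∑ s ∈ signVectors e, genFun (blockFinset 0 π s) =
      (4 : ℚ) • genFun (parityFinset 1 e) := by
  have hB (π : Equiv.Perm (Fin 3)) (s : Fin 3 → ℤˣ) : blockFinset 0 π s = {wreath 1 π} := by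
    ext σ
    rw [mem_blockFinset, Finset.mem_singleton]
    constructor
    · rintro ⟨f, hf, rfl⟩
      rw [show f = 1 from funext hf]
    · rintro rfl
      exact ⟨1, fun _ => rfl, rfl⟩
  have hcard : (signVectors e).card = 4 := by
    rcases Int.units_eq_one_or e with rfl | rfl <;> decide
  have hP : parityFinset 1 e =
      (Finset.univ.filter fun π : Equiv.Perm (Fin 3) => Equiv.Perm.sign π = e).biUnion
        fun π => {wreath 1 π} := by
    ext σ
    simp only [mem_parityFinset, mem_parityClass_succ, ← mem_blockFinset, hB, Finset.mem_biUnion,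
      Finset.mem_filter_univ, Finset.mem_singleton]
    constructor
    · rintro ⟨π, s, h1, -, h⟩
      exact ⟨π, h1, h⟩
    · rintro ⟨π, h1, h⟩
      obtain ⟨s, hs⟩ := Finset.card_pos.1 (hcard ▸ four_pos)
      exact ⟨π, s, h1, (Finset.mem_filter_univ s).1 hs, h⟩
  rw [hP, genFun, Finset.sum_biUnion, Finset.smul_sum]
  · refine Finset.sum_congr rfl fun π _ => ?_
    simp only [hB]
    rw [Finset.sum_const, hcard, ← Nat.cast_smul_eq_nsmul ℚ]
    rfl
  · intro π _ ρ _ h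
    rw [Function.onFun, Finset.disjoint_singleton]
    exact fun h' => h (wreath_injective h').2

theorem genFun_parityFinset (n : ℕ) (e : ℤˣ) :
    genFun (parityFinset n e) = ((parityFinset n 1).card : ℚ) • law (parityLabel e) n := by
  induction n generalizing e with
  | zero =>
    have h (e : ℤˣ) : parityFinset 0 e = {1} := by
      ext σ
      rw [mem_parityFinset, Finset.mem_singleton]
      rfl
    have hc : cycleLengths (1 : Equiv.Perm (Word 0)) = {1} := by
      rw [cycleLengths, Equiv.Perm.parts_partition]
      simp
    rw [h, h, genFun, Finset.sum_singleton, hc, law_zero, Finset.card_singleton, Nat.cast_one,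
      one_smul]
  | succ n ih =>
    -- Proportionality is enough, as comparing total weights determines `q`. This absorbs the
    -- overcounting on level 1.
    obtain ⟨q, hq⟩ : ∃ q : ℚ, genFun (parityFinset (n + 1) e) = q • law (parityLabel e) (n + 1) := by
      have hsum : ∑ π with Equiv.Perm.sign π = e, ∑ s ∈ signVectors e,
          genFun (blockFinset n π s) =
          (12 * ((parityFinset n 1).card : ℚ) ^ 3) • law (parityLabel e) (n + 1) := by
        rcases Int.units_eq_one_or e with rfl | rfl
        · exact sum_genFun_even rfl ih
        · exact sum_genFun_odd rfl ih
      cases n with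
      | zero =>
        rw [sum_genFun_blockFinset_zero] at hsum
        refine ⟨(1 / 4) * (12 * ((parityFinset 0 1).card : ℚ) ^ 3), ?_⟩
        rw [mul_smul, ← hsum, smul_smul]
        norm_num
      | succ n => exact ⟨_, (sum_genFun_blockFinset n e).symm.trans hsum⟩
    have hw := congrArg totalWeight hq
    rw [totalWeight_genFun, map_smul, totalWeight_law, card_parityFinset, smul_eq_mul, mul_one] at hw
    rw [hw, hq]

theorem card_parityFinset_succ_succ (n : ℕ) :
    ((parityFinset (n + 2) 1).card : ℚ) = 12 * ((parityFinset (n + 1) 1).card : ℚ) ^ 3 := by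
  have h := sum_genFun_even (n := n + 1) rfl (genFun_parityFinset (n + 1))
  rw [sum_genFun_blockFinset] at h
  have hw := congrArg totalWeight h
  rwa [totalWeight_genFun, map_smul, totalWeight_law, smul_eq_mul, mul_one] at hw

theorem parityFinset_nonempty (n : ℕ) (e : ℤˣ) : (parityFinset n e).Nonempty := by
  rcases Int.units_eq_one_or e with rfl | rfl
  · exact ⟨_, mem_parityFinset.2 (one_mem_parityClass n)⟩
  · exact ⟨_, mem_parityFinset.2 (y_mem_parityClass n)⟩

theorem card_parityFinset_ne_zero (n : ℕ) : ((parityFinset n 1).card : ℚ) ≠ 0 :=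
  Nat.cast_ne_zero.2 (parityFinset_nonempty n 1).card_ne_zero

theorem blockFinset_nonempty (n : ℕ) (π : Equiv.Perm (Fin 3)) (s : Fin 3 → ℤˣ) :
    (blockFinset n π s).Nonempty := by
  choose f hf using fun a => parityFinset_nonempty n (s a)
  exact ⟨wreath f π, mem_blockFinset.2 ⟨f, fun a => mem_parityFinset.1 (hf a), rfl⟩⟩

/-! ### Cycle data of unions of blocks -/

theorem coe_L (n : ℕ) : (L n : Set (Equiv.Perm (Word n))) = parityFinset n 1 := by
  ext σ
  rw [L_eq, Finset.mem_coe, mem_parityFinset]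
  rfl

/-- Distinct blocks are disjoint here, so generating functions add up; the denominator is the order
of `L (n + 2)`, twelve blocks of `N ^ 3` elements. -/
theorem CD_L {n : ℕ} {I : Finset (Equiv.Perm (Fin 3) × (Fin 3 → ℤˣ))} (hI : I.Nonempty)
    {S : Set (Equiv.Perm (Word (n + 2)))}
    (hS : ∀ σ, σ ∈ S ↔ ∃ p ∈ I, σ ∈ blockClass (n + 1) p.1 p.2) :
    CD (n + 2) S (L (n + 2)) = coeffSet ((1 / (12 * ((parityFinset (n + 1) 1).card : ℚ) ^ 3)) •
      ∑ p ∈ I, genFun (blockFinset (n + 1) p.1 p.2)) := by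
  have e : S = ↑(I.biUnion fun p => blockFinset (n + 1) p.1 p.2) := by
    ext σ
    simp [hS]
  rw [e, coe_L, CD_eq_coeffSet _ (parityFinset_nonempty _ _), card_parityFinset_succ_succ,
    genFun_biUnion]
  obtain ⟨p, hp⟩ := hI
  exact Finset.Nonempty.biUnion ⟨p, hp⟩ fun p _ => blockFinset_nonempty _ _ _

theorem CD_H (n : ℕ) :
    CD (n + 2) (H (n + 2)) (L (n + 2)) = coeffSet ((1 / 12 : ℚ) • law Label.s (n + 1) ^ 3) := by
  rw [CD_L (I := {(1, 1)}) (Finset.singleton_nonempty _)]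
  · have hN := card_parityFinset_ne_zero (n + 1)
    have hs : genFun (parityFinset (n + 1) 1) = _ • law Label.s (n + 1) := genFun_parityFinset _ 1
    generalize ((parityFinset (n + 1) 1).card : ℚ) = N at *
    congr 1
    rw [Finset.sum_singleton, genFun_blockFinset_one]
    simp only [Pi.one_apply, hs]
    rw [← pow_two, ← pow_succ, smul_pow, smul_smul]
    congr 1
    field_simp
  · intro σ
    rw [H_eq]
    simp only [Finset.mem_singleton, exists_eq_left]
    rfl

theorem x_sq_mem_blockClass (n : ℕ) : x (n + 1) ^ 2 ∈ blockClass n (finRotate 3 ^ 2) 1 := by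
  rw [pow_two, pow_two]
  exact blockClass_congr (mul_mem_blockClass (x_mem_blockClass n) (x_mem_blockClass n)) rfl
    fun _ => one_mul _

theorem CD_K (n : ℕ) :
    CD (n + 2) (cosetR (K (n + 2)) (x (n + 2)) ∪ cosetR (K (n + 2)) (x (n + 2) ^ 2)) (L (n + 2)) =
      coeffSet ((2 / 3 : ℚ) • scale 3 (law Label.s (n + 1))) := by
  rw [K_eq, cosetR_kernelGroup (x_mem_blockClass _), cosetR_kernelGroup (x_sq_mem_blockClass _),
    CD_L (I := {finRotate 3, finRotate 3 ^ 2} ×ˢ signVectors 1)]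
  · have hN := card_parityFinset_ne_zero (n + 1)
    have hs : genFun (parityFinset (n + 1) 1) = _ • law Label.s (n + 1) := genFun_parityFinset _ 1
    congr 1
    rw [Finset.sum_product, Finset.sum_insert (by decide), Finset.sum_singleton,
      sum_genFun_three rfl hs (π := finRotate 3) (by decide) (by decide),
      sum_genFun_three rfl hs (π := finRotate 3 ^ 2) (by decide) (by decide), ← two_smul ℚ,
      smul_smul, smul_smul]
    congr 1
    field_simp
    norm_num
  · exact ⟨(finRotate 3, 1), by decide⟩
  · intro σ
    simp only [Set.mem_union, Set.mem_ofPred_eq, signVectors, Finset.mem_product,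
      Finset.mem_insert, Finset.mem_singleton, Finset.mem_filter_univ, Prod.exists]
    constructor
    · rintro (⟨s, h⟩ | ⟨s, h⟩)
      exacts [⟨_, s, ⟨Or.inl rfl, h.1⟩, h.2⟩, ⟨_, s, ⟨Or.inr rfl, h.1⟩, h.2⟩]
    · rintro ⟨π, s, ⟨rfl | rfl, h⟩, h'⟩
      exacts [Or.inl ⟨s, h, h'⟩, Or.inr ⟨s, h, h'⟩]

theorem disjoint_cosetR_K (n : ℕ) :
    Disjoint (cosetR (K (n + 2)) (x (n + 2))) (cosetR (K (n + 2)) (x (n + 2) ^ 2)) := by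
  rw [K_eq, cosetR_kernelGroup (x_mem_blockClass _), cosetR_kernelGroup (x_sq_mem_blockClass _),
    Set.disjoint_left]
  rintro σ ⟨s, -, hs⟩ ⟨t, -, ht⟩
  exact absurd (blockClass_eq_of_mem hs ht).1 (by decide)

theorem conj_z_mem_blockClass (n : ℕ) :
    conj (z (n + 1)) (x (n + 1)) ∈ blockClass n 1 ![-1, 1, -1] :=
  blockClass_congr (conj_mem_blockClass_right (x_mem_blockClass n) (z_mem_blockClass n)) rfl
    (by decide)

theorem conj_sq_z_mem_blockClass (n : ℕ) :
    conj (z (n + 1)) (x (n + 1) ^ 2) ∈ blockClass n 1 ![1, -1, -1] :=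
  blockClass_congr (conj_mem_blockClass_right (x_sq_mem_blockClass n) (z_mem_blockClass n)) rfl
    (by decide)

theorem CD_z (n : ℕ) :
    CD (n + 2) (cosetL (z (n + 2)) (H (n + 2)) ∪ cosetL (conj (z (n + 2)) (x (n + 2))) (H (n + 2)) ∪
        cosetL (conj (z (n + 2)) (x (n + 2) ^ 2)) (H (n + 2))) (L (n + 2)) =
      coeffSet ((1 / 4 : ℚ) • (law Label.n (n + 1) ^ 2 * law Label.s (n + 1))) := by
  rw [H_eq, cosetL_baseGroup (z_mem_blockClass _), cosetL_baseGroup (conj_z_mem_blockClass _),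
    cosetL_baseGroup (conj_sq_z_mem_blockClass _),
    CD_L (I := {(1, ![-1, -1, 1]), (1, ![-1, 1, -1]), (1, ![1, -1, -1])})]
  · have hN := card_parityFinset_ne_zero (n + 1)
    have hs : genFun (parityFinset (n + 1) 1) = _ • law Label.s (n + 1) := genFun_parityFinset _ 1
    have hn : genFun (parityFinset (n + 1) (-1)) = _ • law Label.n (n + 1) :=
      genFun_parityFinset _ (-1)
    generalize ((parityFinset (n + 1) 1).card : ℚ) = N at *
    congr 1
    rw [Finset.sum_insert (by decide), Finset.sum_insert (by decide), Finset.sum_singleton]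
    simp only [genFun_blockFinset_one, Matrix.cons_val, hs, hn]
    -- Three of the twelve blocks, each of mass `N ^ 3`.
    have e : (1 / 4 : ℚ) = 1 / (12 * N ^ 3) * (3 * N ^ 3) := by field_simp; norm_num
    rw [e, mul_smul]
    congr 1
    algebra
  · exact Finset.insert_nonempty _ _
  · intro σ
    simp [or_assoc]

theorem disjoint_cosetL_H {n : ℕ} {g h : Equiv.Perm (Word (n + 2))} {s t : Fin 3 → ℤˣ}
    (hg : g ∈ blockClass (n + 1) 1 s) (hh : h ∈ blockClass (n + 1) 1 t) (hst : s ≠ t) :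
    Disjoint (cosetL g (H (n + 2))) (cosetL h (H (n + 2))) := by
  rw [H_eq, cosetL_baseGroup hg, cosetL_baseGroup hh, Set.disjoint_left]
  exact fun σ h1 h2 => hst (blockClass_eq_of_mem h1 h2).2

theorem CD_y (n : ℕ) :
    CD (n + 1) (cosetR (L (n + 1)) (y (n + 1))) (M (n + 1)) =
      coeffSet ((1 / 2 : ℚ) • law Label.n (n + 1)) := by
  have hS : cosetR (L (n + 1)) (y (n + 1)) = ↑(parityFinset (n + 1) (-1)) := by
    rw [L_eq, cosetR_evenGroup (y_mem_parityClass _)]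
    ext σ
    rw [Finset.mem_coe, mem_parityFinset]
  have hM : (M (n + 1) : Set (Equiv.Perm (Word (n + 1)))) =
      ↑(parityFinset (n + 1) 1 ∪ parityFinset (n + 1) (-1)) := by
    ext σ
    rw [M_eq, Finset.mem_coe, Finset.mem_union, mem_parityFinset, mem_parityFinset]
    constructor
    · rintro ⟨e, he⟩
      rcases Int.units_eq_one_or e with rfl | rfl
      exacts [Or.inl he, Or.inr he]
    · rintro (h | h)
      exacts [⟨_, h⟩, ⟨_, h⟩]
  have hdisj : Disjoint (parityFinset (n + 1) 1) (parityFinset (n + 1) (-1)) :=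
    Finset.disjoint_left.2 fun σ h1 h2 => absurd
      (parityClass_eq_of_mem (mem_parityFinset.1 h1) (mem_parityFinset.1 h2)) (by decide)
  have hN := card_parityFinset_ne_zero (n + 1)
  rw [hS, hM, CD_eq_coeffSet (parityFinset_nonempty _ _)
    ((parityFinset_nonempty _ _).mono Finset.subset_union_left), Finset.card_union_of_disjoint hdisj,
    card_parityFinset _ (-1), genFun_parityFinset, smul_smul, Nat.cast_add]
  congr 2
  field_simp
  norm_num

end

end CubicMarkov

open CubicMarkov
theorem mainTheorem1 (n : ℕ) (hn : 2 ≤ n) :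
    -- (i)
    A₁ n = CD n (H n) (L n) ∧
    -- (ii), with the union disjoint
    (Disjoint (cosetR (K n) (x n)) (cosetR (K n) (x n ^ 2)) ∧
      A₂ n = CD n (cosetR (K n) (x n) ∪ cosetR (K n) (x n ^ 2)) (L n)) ∧
    -- (iii), with the union disjoint
    (Disjoint (cosetL (z n) (H n)) (cosetL (conj (z n) (x n)) (H n)) ∧
      Disjoint (cosetL (z n) (H n)) (cosetL (conj (z n) (x n ^ 2)) (H n)) ∧
      Disjoint (cosetL (conj (z n) (x n)) (H n)) (cosetL (conj (z n) (x n ^ 2)) (H n)) ∧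
      A₃ n =
        CD n
          (cosetL (z n) (H n) ∪ cosetL (conj (z n) (x n)) (H n) ∪
            cosetL (conj (z n) (x n ^ 2)) (H n))
          (L n)) ∧
    -- (iv)
    A₄ (n + 1) = CD n (cosetR (L n) (y n)) (M n) := by
  obtain ⟨n, rfl⟩ := Nat.exists_eq_add_of_le' hn
  refine ⟨?_, ⟨disjoint_cosetR_K n, ?_⟩, ⟨?_, ?_, ?_, ?_⟩, ?_⟩
  · rw [A₁_eq, CD_H]
  · rw [A₂_eq, CD_K]
  · exact disjoint_cosetL_H (z_mem_blockClass _) (conj_z_mem_blockClass _) (by decide)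
  · exact disjoint_cosetL_H (z_mem_blockClass _) (conj_sq_z_mem_blockClass _) (by decide)
  · exact disjoint_cosetL_H (conj_z_mem_blockClass _) (conj_sq_z_mem_blockClass _) (by decide)
  · rw [A₃_eq, CD_z]
  -- The index of `A₄` is one higher because its initial state `[n, 1]` belongs to level 0, whereas
  -- the other initial states belong to level 1.
  · rw [A₄_eq, CD_y]
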